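/- Let $a,b,c,d\in\mathbb R$ with $a>0$, and consider $$x^2y''(x)+(cx+d)\,y'(x)-(ax+b)\,y(x)=0,\qquad 0<x<\infty. \qquad (1)$$ Define $(A_k)_{k\ge0}$ by $A_0=1$ and, for $k\ge1$ (with $A_{-1}=A_{-2}=0$), $$A_k=\frac{4b-(k+\frac12-c)(k-\frac32+c)}{4\sqrt a\,k}\,A_{k-1}+\frac dk\,A_{k-2}+\frac{d\,(k-\frac72+c)}{2\sqrt a\,k}\,A_{k-3}.$$ Then equation (1) has a unique (real-valued, twice differentiable) solution $y_2$ on $(0,\infty)$ with the asymptotic expansion $$y_2(x)\sim x^{\frac14-\frac c2}e^{-2\sqrt{ax}}\sum_{k=0}^\infty A_k\,x^{-k/2}\qquad(x\to\infty),$$ meaning that for every integer $n\ge0$ $$y_2(x)-x^{\frac14-\frac c2}e^{-2\sqrt{ax}}\sum_{k=0}^{n-1}A_kx^{-k/2}=O\!\left(x^{\frac14-\frac c2-\frac n2}e^{-2\sqrt{ax}}\right)\qquad(x\to\infty).$$ The solution $y_2$ is infinitely differentiable on $(0,\infty)$, and the expansion may be differentiated term by term any number of times: for all integers $m,n\ge0$,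 $$y_2^{(m)}(x)-\sum_{k=0}^{n-1}A_k\,\frac{d^m}{dx^m}\!\left[x^{\frac14-\frac c2-\frac k2}e^{-2\sqrt{ax}}\right]=O\!\left(x^{\frac14-\frac c2-\frac{n+m}2}e^{-2\sqrt{ax}}\right)\qquad(x\to\infty).$$ If $b\ge0$, then $y_2$ is positive and strictly decreasing on $(0,\infty)$. -/

import Mathlib

open Set Filter Asymptotics
open scoped Topology ContDiff

namespace DoublyConfluentHeun

/-- `y` is a (twice differentiable, real) solution on `(0, ∞)` of
`x² y'' + (c x + d) y' - (a x + b) y = 0`. -/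
def IsSolution (a b c d : ℝ) (y : ℝ → ℝ) : Prop :=
  ∀ x : ℝ, 0 < x →
    DifferentiableAt ℝ y x ∧ DifferentiableAt ℝ (deriv y) x ∧
      x ^ 2 * deriv (deriv y) x + (c * x + d) * deriv y x - (a * x + b) * y x = 0

/-- The factor of the `(k-1)`-st coefficient in the recursion for the `k`-th one. -/
noncomputable def recFactor (a b c k : ℝ) : ℝ :=
  (4 * b - (k + 1 / 2 - c) * (k - 3 / 2 + c)) / (4 * √a * k)

/-- The coefficients `A k`: `A 0 = 1` and, for `k ≥ 1`, with `A (-1) = A (-2) = 0`,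
`A k = (4 b - (k + 1/2 - c) (k - 3/2 + c)) / (4 √a k) * A (k-1) + d / k * A (k-2)
  + d (k - 7/2 + c) / (2 √a k) * A (k-3)`. -/
noncomputable def coeff (a b c d : ℝ) : ℕ → ℝ
  | 0 => 1
  | 1 => recFactor a b c 1
  | 2 => recFactor a b c 2 * coeff a b c d 1 + d / 2 * coeff a b c d 0
  | k + 3 =>
      recFactor a b c ((k : ℝ) + 3) * coeff a b c d (k + 2)
        + d / ((k : ℝ) + 3) * coeff a b c d (k + 1)
        + d * (((k : ℝ) + 3) - 7 / 2 + c) / (2 * √a * ((k : ℝ) + 3)) * coeff a b c d k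

/-- The function `x ^ (1/4 - c/2 - s/2) * exp (-2 √(a x))`. For `s = k` it is the `k`-th term
(without coefficient) `x ^ (1/4 - c/2) * exp (-2 √(a x)) * x ^ (-k/2)` of the expansion. -/
noncomputable def scale (a c s : ℝ) (x : ℝ) : ℝ :=
  x ^ (1 / 4 - c / 2 - s / 2) * Real.exp (-2 * √(a * x))

/-- `y x ∼ x ^ (1/4 - c/2) * exp (-2 √(a x)) * ∑ A k * x ^ (-k/2)` as `x → ∞`, in the sense of
Poincaré: the error of each partial sum is of the order of the first omitted power. -/
def HasExpansion (a c : ℝ) (A : ℕ → ℝ) (y : ℝ → ℝ) : Prop :=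
  ∀ n : ℕ,
    (fun x : ℝ => y x - x ^ (1 / 4 - c / 2) * Real.exp (-2 * √(a * x)) *
        ∑ k ∈ Finset.range n, A k * x ^ (-(k : ℝ) / 2))
      =O[atTop] (fun x : ℝ => x ^ (1 / 4 - c / 2) * Real.exp (-2 * √(a * x)) * x ^ (-(n : ℝ) / 2))

/-- The expansion may be differentiated term by term, any number `m` of times. The `m`-th
derivative of `scale a c n` is of exact order `scale a c (n + m)`, so the error of each partial
sum of the differentiated series is again of the order of the first omitted term. -/
def HasDifferentiatedExpansions (a c : ℝ) (A : ℕ → ℝ) (y : ℝ → ℝ) : Prop :=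
  ∀ m n : ℕ,
    (fun x : ℝ => iteratedDeriv m y x -
        ∑ k ∈ Finset.range n, A k * iteratedDeriv m (scale a c (k : ℝ)) x)
      =O[atTop] scale a c ((n : ℝ) + (m : ℝ))

end DoublyConfluentHeun

/-!
With `t = √x` and `y x = x ^ (1/4 - c/2) * exp (-2 √(a x)) * w t`, the equation becomes
`w'' = (β - 2 d / t³) w' - g w`, where `β = 4 √a` and `g` is a polynomial in `1 / t` of order
`t⁻²` (`operator_lift`). A solution `w` that tends to `1` solves the Volterra equation
`w = 1 - ∫_t^∞ v`, where `v` is the decaying solution of `v' = (β - 2 d / t³) v - g w`. Its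
Neumann series converges on all of `(0, ∞)`, because the `n`-th term is at most `(B / t) ^ n / n!`
on `[δ, ∞)` (`exists_amplitude`); no separate continuation to small `x` is needed.

The recursion of the coefficients says that the partial sums of `∑ A k * t ^ (-k)` solve the
equation for `w` up to `O(t ^ (-n - 1))` (`residual_add_two`). A bounded solution of
`u' = (β - 2 d / t³) u + h` decays as fast as `h`, since `β > 0` makes all other solutions grow
exponentially (`isBigO_of_hasDerivAt_rate`). Applied to the derivative of the error of a partial
sum, this improves the error bound by one order at a time (`amplitude_expansion`).

For the derivatives, the differential equation for the error of a partial sum shows that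
differentiation does not make the order of the error worse (`derivsIsBigO_error`). The sharp order
follows by passing to a longer partial sum, because the `m`-th derivative of each added term is
smaller by the factor `x ^ (-m/2)` (`iteratedDeriv_scale_isBigO`).

If two solutions have the expansion, their difference `z` is `o(y)`. By Abel's identity the
derivative of `z / y` is a constant divided by a function that tends to zero, so the constant is
zero, `z` vanishes near infinity, and hence everywhere (`IsSolution.eqOn_zero_of_isLittleO`). For
`b ≥ 0`, the product `x ^ c * exp (-d / x) * y * y'` is nondecreasing; being negative near infinity,
it is negative everywhere (`IsSolution.pos_and_strictAntiOn`).
-/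

namespace DoublyConfluentHeun

open MeasureTheory

/-! ### Integrals over half-lines -/

theorem hasDerivAt_integral_Ioi {f : ℝ → ℝ} (hf : ContinuousOn f (Ioi 0))
    (hi : ∀ t, 0 < t → IntegrableOn f (Ioi t)) {t : ℝ} (ht : 0 < t) :
    HasDerivAt (fun s => ∫ r in Ioi s, f r) (-f t) t := by
  have h2 : 0 < t / 2 := by positivity
  have hc : HasDerivAt (fun s => (∫ r in Ioi (t / 2), f r) - ∫ r in (t / 2)..s, f r) (-f t) t := by
    have hint : IntervalIntegrable f volume (t / 2) t := by
      apply ContinuousOn.intervalIntegrable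
      refine hf.mono fun r hr => ?_
      rw [uIcc_of_le (by linarith)] at hr
      exact lt_of_lt_of_le h2 hr.1
    have := intervalIntegral.integral_hasDerivAt_right hint
      (hf.stronglyMeasurableAtFilter isOpen_Ioi t ht) (hf.continuousAt (Ioi_mem_nhds ht))
    simpa using this.const_sub (∫ r in Ioi (t / 2), f r)
  refine hc.congr_of_eventuallyEq ?_
  filter_upwards [Ioi_mem_nhds (show t / 2 < t by linarith)] with s hs
  rw [← intervalIntegral.integral_Ioi_sub_Ioi (hi _ h2) (le_of_lt hs)]
  ring

/-- A function dominated by minus the derivative of a function `H` that tends to `0` is integrable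
at infinity, and its tail integrals are bounded by `H`. -/
theorem abs_integral_Ioi_le_of_hasDerivAt {f H h : ℝ → ℝ} {t : ℝ}
    (hf : ContinuousOn f (Ioi t))
    (hH : ∀ r, t ≤ r → HasDerivAt H (-h r) r) (hfh : ∀ r, t < r → |f r| ≤ h r)
    (h0 : Tendsto H atTop (𝓝 0)) :
    IntegrableOn f (Ioi t) ∧ |∫ r in Ioi t, f r| ≤ H t := by
  have hd : ∀ r ∈ Ici t, HasDerivAt (fun r => -H r) (h r) r := fun r hr =>
    (hH r hr).fun_neg.congr_deriv (neg_neg _)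
  have hpos : ∀ r ∈ Ioi t, 0 ≤ h r := fun r hr => (abs_nonneg _).trans (hfh r hr)
  have hlim : Tendsto (fun r => -H r) atTop (𝓝 0) := by simpa using h0.neg
  have hint : IntegrableOn h (Ioi t) := integrableOn_Ioi_deriv_of_nonneg' hd hpos hlim
  have hval := integral_Ioi_of_hasDerivAt_of_nonneg' hd hpos hlim
  have hae : ∀ᵐ r ∂(volume.restrict (Ioi t)), ‖f r‖ ≤ h r := by
    filter_upwards [ae_restrict_mem measurableSet_Ioi] with r hr using hfh r hr
  refine ⟨Integrable.mono' hint (hf.aestronglyMeasurable measurableSet_Ioi) hae, ?_⟩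
  have := norm_integral_le_of_norm_le hint hae
  rw [hval] at this
  simpa using this

/-! ### The integral equation for the amplitude -/

/-- The integrating factor `exp (-β t - d / t²)` of the first order operator
`u ↦ u' - (β - 2 d / t³) u`. -/
noncomputable def weight (β d t : ℝ) : ℝ := Real.exp (-β * t - d * t⁻¹ ^ 2)

/-- The coefficient `β - 2 d / t³`, minus the logarithmic derivative of `weight β d`. -/
noncomputable def rate (β d t : ℝ) : ℝ := β - 2 * d * t⁻¹ ^ 3

theorem hasDerivAt_inv_pow (k : ℕ) {t : ℝ} (ht : 0 < t) :
    HasDerivAt (fun t : ℝ => t⁻¹ ^ k) (-(k : ℝ) * t⁻¹ ^ (k + 1)) t := by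
  rcases k with _ | k
  · simpa using hasDerivAt_const t (1 : ℝ)
  · refine ((hasDerivAt_inv ht.ne').pow (k + 1)).congr_deriv ?_
    simp only [Nat.add_sub_cancel, ← inv_pow]
    push_cast
    ring

theorem weight_pos (β d t : ℝ) : 0 < weight β d t := Real.exp_pos _

theorem hasDerivAt_weight (β d : ℝ) {t : ℝ} (ht : 0 < t) :
    HasDerivAt (weight β d) (-rate β d t * weight β d t) t := by
  have h := (((hasDerivAt_id t).const_mul (-β)).sub
    ((hasDerivAt_inv_pow 2 ht).const_mul d)).exp
  refine h.congr_deriv ?_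
  simp only [rate, weight, id, Pi.sub_apply]
  push_cast
  ring

theorem continuousOn_weight (β d : ℝ) : ContinuousOn (weight β d) (Ioi 0) := fun _ ht =>
  (hasDerivAt_weight β d ht).continuousAt.continuousWithinAt

theorem weight_le {β d δ t : ℝ} (hδ : 0 < δ) (ht : δ ≤ t) :
    weight β d t ≤ Real.exp (|d| * δ⁻¹ ^ 2) * Real.exp (-β * t) := by
  rw [weight, ← Real.exp_add, Real.exp_le_exp]
  have ht0 : 0 < t := hδ.trans_le ht
  have h1 : t⁻¹ ^ 2 ≤ δ⁻¹ ^ 2 := by gcongr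
  have h2 : -d * t⁻¹ ^ 2 ≤ |d| * δ⁻¹ ^ 2 := by
    have := neg_abs_le d
    gcongr
    linarith
  linarith

theorem inv_weight_le {β d δ t : ℝ} (hδ : 0 < δ) (ht : δ ≤ t) :
    (weight β d t)⁻¹ ≤ Real.exp (|d| * δ⁻¹ ^ 2) * Real.exp (β * t) := by
  rw [weight, ← Real.exp_neg, ← Real.exp_add, Real.exp_le_exp]
  have ht0 : 0 < t := hδ.trans_le ht
  have h1 : t⁻¹ ^ 2 ≤ δ⁻¹ ^ 2 := by gcongr
  have h2 : d * t⁻¹ ^ 2 ≤ |d| * δ⁻¹ ^ 2 := by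
    have := le_abs_self d
    gcongr
  linarith

/-- The candidate for the derivative of the next Picard iterate: the decaying solution `v` of
`v' = rate * v - g * w`. -/
noncomputable def picardDeriv (β d : ℝ) (g w : ℝ → ℝ) (t : ℝ) : ℝ :=
  (weight β d t)⁻¹ * ∫ r in Ioi t, g r * weight β d r * w r

/-- The terms of the Neumann series for the Volterra equation `w = 1 - ∫_t^∞ v`, where `v` is the
decaying solution of `v' = rate * v - g * w`. -/
noncomputable def neumannTerm (β d : ℝ) (g : ℝ → ℝ) : ℕ → ℝ → ℝ
  | 0 => fun _ => 1
  | n + 1 => fun t => -∫ s in Ioi t, picardDeriv β d g (neumannTerm β d g n) s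

theorem tendsto_inv_pow_zero {k : ℕ} (hk : k ≠ 0) :
    Tendsto (fun t : ℝ => t⁻¹ ^ k) atTop (𝓝 0) := by
  simpa [hk] using (tendsto_inv_atTop_zero (𝕜 := ℝ)).pow k

section Picard

variable {β d : ℝ} {g w : ℝ → ℝ}

theorem picardDeriv_bound (hβ : 0 < β) (hg : ContinuousOn g (Ioi 0))
    (hw : ContinuousOn w (Ioi 0)) {δ M W : ℝ} {n : ℕ} (hδ : 0 < δ)
    (hgM : ∀ t, δ ≤ t → |g t| ≤ M * t⁻¹ ^ 2) (hwW : ∀ t, δ ≤ t → |w t| ≤ W * t⁻¹ ^ n)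
    {t : ℝ} (ht : δ ≤ t) :
    IntegrableOn (fun r => g r * weight β d r * w r) (Ioi t) ∧
      |picardDeriv β d g w t| ≤
        M * Real.exp (|d| * δ⁻¹ ^ 2) ^ 2 / β * W * t⁻¹ ^ (n + 2) := by
  set E := Real.exp (|d| * δ⁻¹ ^ 2) with hE
  have hE0 : 0 < E := Real.exp_pos _
  have ht0 : 0 < t := hδ.trans_le ht
  have hM : 0 ≤ M := by
    have := (abs_nonneg _).trans (hgM t ht)
    exact nonneg_of_mul_nonneg_left this (by positivity)
  have hW : 0 ≤ W := by
    have := (abs_nonneg _).trans (hwW t ht)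
    exact nonneg_of_mul_nonneg_left this (by positivity)
  set K := M * E * W with hK
  have hK0 : 0 ≤ K := by positivity
  have key := abs_integral_Ioi_le_of_hasDerivAt (t := t)
    (f := fun r => g r * weight β d r * w r)
    (H := fun r => K / β * (r⁻¹ ^ (n + 2) * Real.exp (-β * r)))
    (h := fun r => K / β * ((n + 2 : ℕ) * r⁻¹ ^ (n + 3) * Real.exp (-β * r)
      + β * r⁻¹ ^ (n + 2) * Real.exp (-β * r)))
    (((hg.mul (continuousOn_weight β d)).mul hw).mono (Ioi_subset_Ioi ht0.le))
    (fun r hr => by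
      have := ((hasDerivAt_inv_pow (n + 2) (ht0.trans_le hr)).mul
        (((hasDerivAt_id r).const_mul (-β)).exp)).const_mul (K / β)
      refine this.congr_deriv ?_
      simp only [id]
      ring)
    (fun r hr => by
      have hr0 : 0 < r := ht0.trans hr
      have h1 := hgM r (ht.trans hr.le)
      have h2 := hwW r (ht.trans hr.le)
      have h3 := weight_le (β := β) (d := d) hδ (ht.trans hr.le)
      have h4 : |g r * weight β d r * w r|
          ≤ (M * r⁻¹ ^ 2) * (E * Real.exp (-β * r)) * (W * r⁻¹ ^ n) := by
        rw [abs_mul, abs_mul, abs_of_pos (weight_pos β d r)]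
        have := weight_pos β d r
        gcongr
      refine h4.trans ?_
      have h5 : K / β * (β * r⁻¹ ^ (n + 2) * Real.exp (-β * r))
          = (M * r⁻¹ ^ 2) * (E * Real.exp (-β * r)) * (W * r⁻¹ ^ n) := by
        rw [hK, ← mul_assoc, ← mul_assoc, div_mul_cancel₀ _ hβ.ne']
        ring
      rw [mul_add, h5]
      have : 0 ≤ K / β * ((n + 2 : ℕ) * r⁻¹ ^ (n + 3) * Real.exp (-β * r)) := by positivity
      linarith)
    (by
      have h1 := tendsto_inv_pow_zero (k := n + 2) (by omega)
      have h2 : Tendsto (fun r : ℝ => Real.exp (-β * r)) atTop (𝓝 0) := by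
        refine Real.tendsto_exp_atBot.comp ?_
        exact tendsto_id.const_mul_atTop_of_neg (by linarith)
      simpa using (h1.mul h2).const_mul (K / β))
  refine ⟨key.1, ?_⟩
  rw [picardDeriv, abs_mul, abs_of_pos (inv_pos.2 (weight_pos β d t))]
  calc _ ≤ (E * Real.exp (β * t)) * (K / β * (t⁻¹ ^ (n + 2) * Real.exp (-β * t))) := by
        have := inv_weight_le (β := β) (d := d) hδ ht
        have := weight_pos β d t
        gcongr
        exact key.2
    _ = M * E ^ 2 / β * W * t⁻¹ ^ (n + 2) * (Real.exp (β * t) * Real.exp (-β * t)) := by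
        rw [hK]; ring
    _ = _ := by rw [← Real.exp_add]; simp

theorem hasDerivAt_picardDeriv (hg : ContinuousOn g (Ioi 0)) (hw : ContinuousOn w (Ioi 0))
    (hi : ∀ t, 0 < t → IntegrableOn (fun r => g r * weight β d r * w r) (Ioi t))
    {t : ℝ} (ht : 0 < t) :
    HasDerivAt (picardDeriv β d g w) (rate β d t * picardDeriv β d g w t - g t * w t) t := by
  have h1 : HasDerivAt (fun s => ∫ r in Ioi s, g r * weight β d r * w r)
      (-(g t * weight β d t * w t)) t :=
    hasDerivAt_integral_Ioi ((hg.mul (continuousOn_weight β d)).mul hw) hi ht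
  have h2 := (hasDerivAt_weight β d ht).inv (weight_pos β d t).ne'
  refine (h2.mul h1).congr_deriv ?_
  have := (weight_pos β d t).ne'
  simp only [picardDeriv, Pi.inv_apply]
  field_simp
  ring

/-- One step of the iteration: a bound of size `(B / t) ^ n / n!` is passed on with `n + 1` in
place of `n`, so that the Neumann series converges on the whole half-line `(0, ∞)`. -/
theorem picard_step (hβ : 0 < β) (hg : ContinuousOn g (Ioi 0))
    (hgM : ∀ δ, 0 < δ → ∃ M, ∀ t, δ ≤ t → |g t| ≤ M * t⁻¹ ^ 2) {n : ℕ}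
    (hc : ContinuousOn w (Ioi 0))
    (hb : ∀ δ M, 0 < δ → (∀ t, δ ≤ t → |g t| ≤ M * t⁻¹ ^ 2) → ∀ t, δ ≤ t →
      |w t| ≤ (M * Real.exp (|d| * δ⁻¹ ^ 2) ^ 2 / β) ^ n / n.factorial * t⁻¹ ^ n) :
    (∀ t, 0 < t → HasDerivAt (picardDeriv β d g w)
      (rate β d t * picardDeriv β d g w t - g t * w t) t) ∧
    (∀ t, 0 < t → HasDerivAt (fun t => -∫ s in Ioi t, picardDeriv β d g w s)
      (picardDeriv β d g w t) t) ∧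
    ∀ δ M, 0 < δ → (∀ t, δ ≤ t → |g t| ≤ M * t⁻¹ ^ 2) → ∀ t, δ ≤ t →
      |∫ s in Ioi t, picardDeriv β d g w s| ≤
        (M * Real.exp (|d| * δ⁻¹ ^ 2) ^ 2 / β) ^ (n + 1) / (n + 1).factorial
          * t⁻¹ ^ (n + 1) := by
  have hd : ∀ t, 0 < t → HasDerivAt (picardDeriv β d g w)
      (rate β d t * picardDeriv β d g w t - g t * w t) t := by
    refine fun t ht => hasDerivAt_picardDeriv hg hc (fun t ht => ?_) ht
    obtain ⟨M, hM⟩ := hgM t ht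
    exact (picardDeriv_bound hβ hg hc ht hM (hb t M ht hM) le_rfl).1
  have hvc : ContinuousOn (picardDeriv β d g w) (Ioi 0) := fun t ht =>
    (hd t ht).continuousAt.continuousWithinAt
  have tail : ∀ δ M, 0 < δ → (∀ t, δ ≤ t → |g t| ≤ M * t⁻¹ ^ 2) → ∀ t, δ ≤ t →
      IntegrableOn (picardDeriv β d g w) (Ioi t) ∧
      |∫ s in Ioi t, picardDeriv β d g w s| ≤
        (M * Real.exp (|d| * δ⁻¹ ^ 2) ^ 2 / β) ^ (n + 1) / (n + 1).factorial
          * t⁻¹ ^ (n + 1) := by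
    intro δ M hδ hM t ht
    have ht0 : 0 < t := hδ.trans_le ht
    set B := M * Real.exp (|d| * δ⁻¹ ^ 2) ^ 2 / β with hB
    refine abs_integral_Ioi_le_of_hasDerivAt
      (H := fun t => B ^ (n + 1) / (n + 1).factorial * t⁻¹ ^ (n + 1))
      (h := fun t => B * (B ^ n / n.factorial) * t⁻¹ ^ (n + 2))
      (hvc.mono (Ioi_subset_Ioi ht0.le)) (fun r hr => ?_) (fun r hr => ?_) ?_
    · refine ((hasDerivAt_inv_pow (n + 1) (ht0.trans_le hr)).const_mul _).congr_deriv ?_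
      have : ((n.factorial : ℕ) : ℝ) ≠ 0 := by positivity
      rw [Nat.factorial_succ]
      push_cast
      field_simp
      ring
    · exact (picardDeriv_bound hβ hg hc hδ hM (hb δ M hδ hM) (ht.trans hr.le)).2
    · simpa using (tendsto_inv_pow_zero (k := n + 1) (by omega)).const_mul
        (B ^ (n + 1) / ((n + 1).factorial : ℝ))
  refine ⟨hd, fun t ht => ?_, fun δ M hδ hM t ht => (tail δ M hδ hM t ht).2⟩
  refine (hasDerivAt_integral_Ioi hvc (fun s hs => ?_) ht).fun_neg.congr_deriv (neg_neg _)
  obtain ⟨M, hM⟩ := hgM s hs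
  exact (tail s M hs hM s le_rfl).1

theorem neumannTerm_spec (hβ : 0 < β) (hg : ContinuousOn g (Ioi 0))
    (hgM : ∀ δ, 0 < δ → ∃ M, ∀ t, δ ≤ t → |g t| ≤ M * t⁻¹ ^ 2) (n : ℕ) :
    ContinuousOn (neumannTerm β d g n) (Ioi 0) ∧
      ∀ δ M, 0 < δ → (∀ t, δ ≤ t → |g t| ≤ M * t⁻¹ ^ 2) → ∀ t, δ ≤ t →
        |neumannTerm β d g n t| ≤
          (M * Real.exp (|d| * δ⁻¹ ^ 2) ^ 2 / β) ^ n / n.factorial * t⁻¹ ^ n := by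
  induction n with
  | zero =>
    refine ⟨continuousOn_const, fun δ M _ _ t _ => ?_⟩
    simp [neumannTerm]
  | succ n ih =>
    obtain ⟨-, h1, h2⟩ := picard_step hβ hg hgM ih.1 ih.2
    refine ⟨fun t ht => (h1 t ht).continuousAt.continuousWithinAt, fun δ M hδ hM t ht => ?_⟩
    simpa [neumannTerm] using h2 δ M hδ hM t ht

/-- The second order equation `w'' = rate * w' - g * w` has a solution on `(0, ∞)` that tends to
`1` at infinity and has a bounded derivative there: the sum of the Neumann series. -/
theorem exists_amplitude (hβ : 0 < β) (hg : ContinuousOn g (Ioi 0))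
    (hgM : ∀ δ, 0 < δ → ∃ M, ∀ t, δ ≤ t → |g t| ≤ M * t⁻¹ ^ 2) :
    ∃ w v : ℝ → ℝ, (∀ t, 0 < t → HasDerivAt w (v t) t) ∧
      (∀ t, 0 < t → HasDerivAt v (rate β d t * v t - g t * w t) t) ∧
      Tendsto w atTop (𝓝 1) ∧ v =O[atTop] (fun _ => (1 : ℝ)) := by
  set W : ℕ → ℝ → ℝ := neumannTerm β d g with hW
  set V : ℕ → ℝ → ℝ := fun n => picardDeriv β d g (W n) with hV
  have spec := fun n => neumannTerm_spec (d := d) hβ hg hgM n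
  have step := fun n => picard_step (d := d) hβ hg hgM (spec n).1 (spec n).2
  -- Uniform bounds on `[δ, ∞)`, by the terms of an exponential series.
  have bounds : ∀ δ, 0 < δ → ∃ B C : ℝ, 0 ≤ C ∧ ∀ n t, δ ≤ t →
      |W n t| ≤ B ^ n / n.factorial * t⁻¹ ^ n ∧
      |W n t| ≤ |B / δ| ^ n / n.factorial ∧ |V n t| ≤ C * (|B / δ| ^ n / n.factorial) := by
    intro δ hδ
    obtain ⟨M, hM⟩ := hgM δ hδ
    obtain ⟨B, hB⟩ : ∃ B, B = M * Real.exp (|d| * δ⁻¹ ^ 2) ^ 2 / β := ⟨_, rfl⟩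
    have hWB : ∀ n t, δ ≤ t → |W n t| ≤ B ^ n / n.factorial * t⁻¹ ^ n := by
      rw [hB]
      exact fun n => (spec n).2 δ M hδ hM
    have hWb : ∀ n t, δ ≤ t → |W n t| ≤ |B / δ| ^ n / n.factorial := by
      intro n t ht
      have ht0 : 0 < t := hδ.trans_le ht
      refine (hWB n t ht).trans ((le_abs_self _).trans ?_)
      rw [abs_mul, abs_div, abs_pow, Nat.abs_cast, abs_of_pos (show 0 < t⁻¹ ^ n by positivity),
        abs_div, abs_of_pos hδ, div_eq_mul_inv |B| δ, mul_pow, mul_div_right_comm]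
      gcongr
    refine ⟨B, |B| * δ⁻¹ ^ 2, by positivity, fun n t ht =>
      ⟨hWB n t ht, hWb n t ht, ?_⟩⟩
    have ht0 : 0 < t := hδ.trans_le ht
    refine (picardDeriv_bound hβ hg (spec n).1 hδ hM
      (hWB n) ht).2.trans ((le_abs_self _).trans ?_)
    rw [← hB, abs_mul, abs_mul, abs_div, abs_pow, Nat.abs_cast,
      abs_of_pos (show 0 < t⁻¹ ^ (n + 2) by positivity), abs_div B, abs_of_pos hδ]
    calc |B| * (|B| ^ n / n.factorial) * t⁻¹ ^ (n + 2)
        ≤ |B| * (|B| ^ n / n.factorial) * δ⁻¹ ^ (n + 2) := by gcongr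
      _ = _ := by rw [div_eq_mul_inv |B| δ, mul_pow]; ring
  have sumExp : ∀ x : ℝ, Summable fun n : ℕ => x ^ n / n.factorial :=
    Real.summable_pow_div_factorial
  have hsW : ∀ t, 0 < t → Summable fun n => W n t := by
    intro t ht
    obtain ⟨B, C, -, h⟩ := bounds t ht
    exact Summable.of_norm_bounded (sumExp _) fun n => (h n t le_rfl).2.1
  have hsV : ∀ t, 0 < t → Summable fun n => V n t := by
    intro t ht
    obtain ⟨B, C, -, h⟩ := bounds t ht
    exact Summable.of_norm_bounded ((sumExp _).mul_left C) fun n => (h n t le_rfl).2.2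
  have hVW : ∀ n t, 0 < t → HasDerivAt (W (n + 1)) (V n t) t := fun n => (step n).2.1
  have hw : ∀ t, 0 < t → HasDerivAt (fun t => ∑' n, W (n + 1) t) (∑' n, V n t) t := by
    intro t ht
    obtain ⟨B, C, -, h⟩ := bounds (t / 2) (by positivity)
    refine hasDerivAt_tsum_of_isPreconnected (t := Ioi (t / 2)) ((sumExp |B / (t / 2)|).mul_left C)
      isOpen_Ioi isPreconnected_Ioi (fun n y hy => hVW n y ?_)
      (fun n y hy => (h n y (le_of_lt hy)).2.2) (y₀ := t) (half_lt_self ht)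
      ((summable_nat_add_iff 1).2 (hsW t ht)) (half_lt_self ht)
    exact (half_pos ht).trans hy
  refine ⟨fun t => 1 + ∑' n, W (n + 1) t, fun t => ∑' n, V n t, fun t ht => ?_, fun t ht => ?_,
    ?_, ?_⟩
  · simpa using (hw t ht).const_add 1
  · obtain ⟨B, C, hC, h⟩ := bounds (t / 2) (by positivity)
    obtain ⟨M, hM⟩ := hgM (t / 2) (by positivity)
    have hM0 : 0 ≤ M := by
      have := (abs_nonneg _).trans (hM t (half_lt_self ht).le)
      exact nonneg_of_mul_nonneg_left this (by positivity)
    set R := |β| + |2 * d| * (t / 2)⁻¹ ^ 3 with hR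
    have hRb : ∀ y, t / 2 ≤ y → |rate β d y| ≤ R := by
      intro y hy
      have hy0 : 0 < y := (half_pos ht).trans_le hy
      refine (abs_sub _ _).trans ?_
      rw [abs_mul (2 * d), abs_of_pos (show 0 < y⁻¹ ^ 3 by positivity), hR]
      gcongr
    have key := hasDerivAt_tsum_of_isPreconnected (t := Ioi (t / 2)) (g := V)
      (g' := fun n y => rate β d y * V n y - g y * W n y)
      ((sumExp |B / (t / 2)|).mul_left (R * C + M * (t / 2)⁻¹ ^ 2))
      isOpen_Ioi isPreconnected_Ioi (fun n y hy => (step n).1 y ((half_pos ht).trans hy))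
      (fun n y hy => ?_) (y₀ := t) (half_lt_self ht) (hsV t ht) (half_lt_self ht)
    · refine key.congr_deriv ?_
      rw [((hsV t ht).mul_left _).tsum_sub ((hsW t ht).mul_left _), tsum_mul_left, tsum_mul_left,
        (hsW t ht).tsum_eq_zero_add]
      rfl
    · have hy0 : 0 < y := (half_pos ht).trans hy
      have h1 := hRb y (le_of_lt hy)
      have h2 := (h n y (le_of_lt hy)).2.2
      have h3 := (h n y (le_of_lt hy)).2.1
      have h4 : |g y| ≤ M * (t / 2)⁻¹ ^ 2 := by
        refine (hM y (le_of_lt hy)).trans ?_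
        have : t / 2 ≤ y := le_of_lt hy
        gcongr
      refine (abs_sub _ _).trans ?_
      rw [abs_mul, abs_mul, add_mul, mul_assoc R]
      gcongr
  · obtain ⟨B, C, -, h⟩ := bounds 1 one_pos
    have : Tendsto (fun t => ∑' n, W (n + 1) t) atTop (𝓝 (∑' _ : ℕ, (0 : ℝ))) := by
      refine tendsto_tsum_of_dominated_convergence ((summable_nat_add_iff 1).2 (sumExp |B / 1|))
        (fun n => ?_) ?_
      · have h0 := (tendsto_inv_pow_zero (k := n + 1) (by omega)).const_mul
          (B ^ (n + 1) / ((n + 1).factorial : ℝ))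
        rw [mul_zero] at h0
        refine squeeze_zero_norm' ?_ h0
        filter_upwards [eventually_ge_atTop 1] with t ht using (h (n + 1) t ht).1
      · filter_upwards [eventually_ge_atTop 1] with t ht n using (h (n + 1) t ht).2.1
    simpa using this.const_add 1
  · obtain ⟨B, C, -, h⟩ := bounds 1 one_pos
    refine IsBigO.of_bound (∑' n : ℕ, C * (|B / 1| ^ n / n.factorial)) ?_
    filter_upwards [eventually_ge_atTop 1] with t ht
    rw [norm_one, mul_one]
    exact tsum_of_norm_bounded ((sumExp |B / 1|).mul_left C).hasSum fun n => (h n t ht).2.2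

end Picard

/-! ### Decay estimates from differential inequalities -/

/-- A function that increases to the limit `0` is nonpositive. -/
theorem nonpos_of_hasDerivAt_nonneg_of_tendsto {f f' : ℝ → ℝ} {T : ℝ}
    (hf : ∀ t, T ≤ t → HasDerivAt f (f' t) t) (hf' : ∀ t, T ≤ t → 0 ≤ f' t)
    (h0 : Tendsto f atTop (𝓝 0)) {t : ℝ} (ht : T ≤ t) : f t ≤ 0 := by
  have hm : MonotoneOn f (Ici T) := by
    refine monotoneOn_of_deriv_nonneg (convex_Ici T)
      (fun s hs => (hf s hs).continuousAt.continuousWithinAt) (fun s hs => ?_) (fun s hs => ?_)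
    all_goals rw [interior_Ici] at hs
    · exact (hf s (le_of_lt hs)).differentiableAt.differentiableWithinAt
    · rw [(hf s (le_of_lt hs)).deriv]
      exact hf' s (le_of_lt hs)
  refine ge_of_tendsto h0 ?_
  filter_upwards [eventually_ge_atTop t] with s hs
  exact hm ht (ht.trans hs) hs

theorem isBigO_of_eventually_le_of_eventually_neg_le {f : ℝ → ℝ} {C : ℝ} {q : ℕ}
    (h1 : ∀ᶠ t in atTop, f t ≤ C * t⁻¹ ^ q) (h2 : ∀ᶠ t in atTop, -f t ≤ C * t⁻¹ ^ q) :
    f =O[atTop] fun t => t⁻¹ ^ q := by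
  refine IsBigO.of_bound C ?_
  filter_upwards [h1, h2, eventually_gt_atTop 0] with t h1 h2 ht
  rw [Real.norm_eq_abs, Real.norm_eq_abs, abs_of_pos (show 0 < t⁻¹ ^ q by positivity)]
  exact abs_le'.2 ⟨h1, h2⟩

theorem tendsto_weight_zero {β : ℝ} (d : ℝ) (hβ : 0 < β) :
    Tendsto (weight β d) atTop (𝓝 0) := by
  refine Real.tendsto_exp_atBot.comp ?_
  have h1 : Tendsto (fun t : ℝ => -β * t) atTop atBot :=
    tendsto_id.const_mul_atTop_of_neg (by linarith)
  have h2 := ((tendsto_inv_pow_zero two_ne_zero).const_mul d).neg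
  exact h1.atBot_add h2

theorem tendsto_rate (β d : ℝ) : Tendsto (rate β d) atTop (𝓝 β) := by
  have h := ((tendsto_inv_pow_zero three_ne_zero).const_mul (2 * d)).const_sub β
  rwa [mul_zero, sub_zero] at h

/-- A bounded solution of `u' = rate * u + h` decays as fast as `h`: all other solutions grow
exponentially. -/
theorem isBigO_of_hasDerivAt_rate {β d : ℝ} (hβ : 0 < β) {u h : ℝ → ℝ} {q : ℕ}
    (hu : ∀ t, 0 < t → HasDerivAt u (rate β d t * u t + h t) t)
    (hb : u =O[atTop] fun _ => (1 : ℝ)) (hh : h =O[atTop] fun t => t⁻¹ ^ q) :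
    u =O[atTop] fun t => t⁻¹ ^ q := by
  obtain ⟨K, hK0, hK⟩ := hh.exists_nonneg
  have hK := hK.bound
  have main : ∀ u h : ℝ → ℝ, (∀ t, 0 < t → HasDerivAt u (rate β d t * u t + h t) t) →
      (u =O[atTop] fun _ => (1 : ℝ)) → (∀ᶠ t in atTop, ‖h t‖ ≤ K * ‖t⁻¹ ^ q‖) →
      ∀ᶠ t in atTop, u t ≤ 2 * K / β * t⁻¹ ^ q := by
    intro u h hu hb hK
    obtain ⟨T, hT⟩ := eventually_atTop.1 ((hK.and (eventually_gt_atTop 0)).and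
      ((tendsto_rate β d).eventually (Ioi_mem_nhds (half_lt_self hβ))))
    filter_upwards [eventually_ge_atTop T] with t ht
    -- `(u - C t ^ (-q)) * weight` is increasing for `C = 2 K / β`, since `rate ≥ β / 2`.
    have key := nonpos_of_hasDerivAt_nonneg_of_tendsto (T := T)
      (f := fun t => (u t - 2 * K / β * t⁻¹ ^ q) * weight β d t)
      (f' := fun t => (h t + 2 * K / β * (q * t⁻¹ ^ (q + 1)) + rate β d t * (2 * K / β * t⁻¹ ^ q))
        * weight β d t)
      (fun t ht => by
        have ht0 := (hT t ht).1.2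
        refine (((hu t ht0).sub ((hasDerivAt_inv_pow q ht0).const_mul _)).mul
          (hasDerivAt_weight β d ht0)).congr_deriv ?_
        simp only [Pi.sub_apply]
        ring)
      (fun t ht => by
        obtain ⟨⟨h1, ht0⟩, h2⟩ := hT t ht
        have hpos : 0 < t⁻¹ ^ q := by positivity
        rw [Real.norm_eq_abs, Real.norm_eq_abs, abs_of_pos hpos] at h1
        have h3 := neg_le_of_abs_le h1
        have h4 : K * t⁻¹ ^ q ≤ rate β d t * (2 * K / β * t⁻¹ ^ q) := by
          calc K * t⁻¹ ^ q = β / 2 * (2 * K / β * t⁻¹ ^ q) := by field_simp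
            _ ≤ _ := by
              have : β / 2 ≤ rate β d t := le_of_lt h2
              gcongr
        have h5 : 0 ≤ 2 * K / β * (q * t⁻¹ ^ (q + 1)) := by positivity
        have := weight_pos β d t
        refine mul_nonneg ?_ this.le
        linarith)
      (by
        have h1 : (fun t : ℝ => 2 * K / β * t⁻¹ ^ q) =O[atTop] fun _ => (1 : ℝ) := by
          refine IsBigO.const_mul_left ?_ _
          simpa using (((tendsto_inv_atTop_zero (𝕜 := ℝ)).isBigO_one ℝ).pow q)
        have h2 := (hb.sub h1).mul_isLittleO ((isLittleO_one_iff ℝ).2 (tendsto_weight_zero d hβ))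
        simpa using h2) ht
    have := nonpos_of_mul_nonpos_left key (weight_pos β d t)
    linarith
  refine isBigO_of_eventually_le_of_eventually_neg_le (main u h hu hb hK)
    (main (fun t => -u t) (fun t => -h t) (fun t ht => ?_) hb.neg_left (by simpa using hK))
  exact (hu t ht).fun_neg.congr_deriv (by ring)

theorem isBigO_of_hasDerivAt_of_tendsto {e f : ℝ → ℝ} {q : ℕ}
    (he : ∀ t, 0 < t → HasDerivAt e (f t) t) (h0 : Tendsto e atTop (𝓝 0))
    (hf : f =O[atTop] fun t => t⁻¹ ^ (q + 2)) : e =O[atTop] fun t => t⁻¹ ^ (q + 1) := by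
  obtain ⟨K, hK0, hK⟩ := hf.exists_nonneg
  have hK := hK.bound
  have main : ∀ e f : ℝ → ℝ, (∀ t, 0 < t → HasDerivAt e (f t) t) → Tendsto e atTop (𝓝 0) →
      (∀ᶠ t in atTop, ‖f t‖ ≤ K * ‖t⁻¹ ^ (q + 2)‖) →
      ∀ᶠ t in atTop, e t ≤ K * t⁻¹ ^ (q + 1) := by
    intro e f he h0 hK
    obtain ⟨T, hT⟩ := eventually_atTop.1 (hK.and (eventually_gt_atTop 0))
    filter_upwards [eventually_ge_atTop T] with t ht
    have key := nonpos_of_hasDerivAt_nonneg_of_tendsto (T := T)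
      (f := fun t => e t - K * t⁻¹ ^ (q + 1))
      (f' := fun t => f t + K * ((q + 1 : ℕ) * t⁻¹ ^ (q + 2)))
      (fun t ht => by
        refine ((he t (hT t ht).2).sub
          ((hasDerivAt_inv_pow (q + 1) (hT t ht).2).const_mul K)).congr_deriv ?_
        ring)
      (fun t ht => by
        obtain ⟨h1, ht0⟩ := hT t ht
        have hpos : 0 < t⁻¹ ^ (q + 2) := by positivity
        rw [Real.norm_eq_abs, Real.norm_eq_abs, abs_of_pos hpos] at h1
        have h3 := neg_le_of_abs_le h1
        have h4 : 0 ≤ K * (q * t⁻¹ ^ (q + 2)) := by positivity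
        push_cast
        linarith)
      (by simpa using h0.sub ((tendsto_inv_pow_zero (k := q + 1) (by omega)).const_mul K)) ht
    linarith
  refine isBigO_of_eventually_le_of_eventually_neg_le (main e f he h0 hK)
    (main (fun t => -e t) (fun t => -f t) (fun t ht => (he t ht).fun_neg) (by simpa using h0.neg)
      (by simpa using hK))

/-! ### The formal series and its residual -/

/-- The coefficient `g` in the equation `w'' = rate * w' - g * w` that the amplitude
`w t = t ^ (c - 1/2) * exp (2 √a t) * y (t ^ 2)` of a solution `y` satisfies. -/
noncomputable def potential (a b c d t : ℝ) : ℝ :=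
  ((1 - 2 * c) * (2 * c - 3) / 4 - 4 * b) * t⁻¹ ^ 2 - 4 * d * √a * t⁻¹ ^ 3
    + d * (1 - 2 * c) * t⁻¹ ^ 4

/-- The partial sum `∑ A k * t ^ (-k)` over `k < n`. -/
noncomputable def partialSum (A : ℕ → ℝ) (n : ℕ) (t : ℝ) : ℝ :=
  ∑ k ∈ Finset.range n, A k * t⁻¹ ^ k

/-- The derivative of `partialSum A n`. -/
noncomputable def partialSumDeriv (A : ℕ → ℝ) (n : ℕ) (t : ℝ) : ℝ :=
  ∑ k ∈ Finset.range n, A k * (-(k : ℝ) * t⁻¹ ^ (k + 1))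

/-- The second derivative of `partialSum A n`. -/
noncomputable def partialSumDeriv2 (A : ℕ → ℝ) (n : ℕ) (t : ℝ) : ℝ :=
  ∑ k ∈ Finset.range n, A k * (k * (k + 1) * t⁻¹ ^ (k + 2))

theorem hasDerivAt_partialSum (A : ℕ → ℝ) (n : ℕ) {t : ℝ} (ht : 0 < t) :
    HasDerivAt (partialSum A n) (partialSumDeriv A n t) t :=
  HasDerivAt.fun_sum fun k _ => (hasDerivAt_inv_pow k ht).const_mul (A k)

theorem hasDerivAt_partialSumDeriv (A : ℕ → ℝ) (n : ℕ) {t : ℝ} (ht : 0 < t) :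
    HasDerivAt (partialSumDeriv A n) (partialSumDeriv2 A n t) t := by
  refine HasDerivAt.fun_sum fun k _ => ?_
  refine (((hasDerivAt_inv_pow (k + 1) ht).const_mul (-(k : ℝ))).const_mul (A k)).congr_deriv ?_
  push_cast
  ring

/-- What is left when the partial sum is inserted into `w'' - rate * w' + g * w`. -/
noncomputable def residual (a b c d : ℝ) (n : ℕ) (t : ℝ) : ℝ :=
  partialSumDeriv2 (coeff a b c d) n t
    - rate (4 * √a) d t * partialSumDeriv (coeff a b c d) n t
    + potential a b c d t * partialSum (coeff a b c d) n t

theorem residual_zero (a b c d t : ℝ) : residual a b c d 0 t = 0 := by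
  simp [residual, partialSum, partialSumDeriv, partialSumDeriv2]

theorem residual_succ (a b c d : ℝ) (n : ℕ) (t : ℝ) :
    residual a b c d (n + 1) t = residual a b c d n t + coeff a b c d n *
      (4 * √a * n * t⁻¹ ^ (n + 1)
        + (n * (n + 1) + (1 - 2 * c) * (2 * c - 3) / 4 - 4 * b) * t⁻¹ ^ (n + 2)
        - 4 * d * √a * t⁻¹ ^ (n + 3) + d * (1 - 2 * c - 2 * n) * t⁻¹ ^ (n + 4)) := by
  simp only [residual, partialSum, partialSumDeriv, partialSumDeriv2, Finset.sum_range_succ, rate,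
    potential]
  ring

theorem coeff_succ_three {a : ℝ} (ha : 0 < a) (b c d : ℝ) (n : ℕ) :
    4 * √a * (n + 3) * coeff a b c d (n + 3) =
      -((n + 2) * (n + 3) + (1 - 2 * c) * (2 * c - 3) / 4 - 4 * b) * coeff a b c d (n + 2)
        + 4 * d * √a * coeff a b c d (n + 1) - d * (1 - 2 * c - 2 * n) * coeff a b c d n := by
  have hs : √a ≠ 0 := (Real.sqrt_pos.2 ha).ne'
  have hn : (n : ℝ) + 3 ≠ 0 := by positivity
  rw [coeff, recFactor]
  field_simp
  ring

/-- By the recursion of the coefficients, only three powers remain in the residual of a partial sum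
with `n + 2` terms, and all powers up to `t ^ (-(n + 2))` cancel. -/
theorem residual_add_two {a : ℝ} (ha : 0 < a) (b c d : ℝ) (n : ℕ) (t : ℝ) :
    residual a b c d (n + 2) t =
      -(4 * √a * (n + 2) * coeff a b c d (n + 2)) * t⁻¹ ^ (n + 3)
      + (-4 * d * √a * coeff a b c d (n + 1) + d * (1 - 2 * c - 2 * n) * coeff a b c d n)
        * t⁻¹ ^ (n + 4)
      + d * (1 - 2 * c - 2 * (n + 1)) * coeff a b c d (n + 1) * t⁻¹ ^ (n + 5) := by
  induction n with
  | zero =>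
    have hs : √a ≠ 0 := (Real.sqrt_pos.2 ha).ne'
    rw [residual_succ, residual_succ, residual_zero]
    simp only [coeff, recFactor]
    push_cast
    generalize t⁻¹ = τ
    field_simp
    ring
  | succ n ih =>
    rw [residual_succ, ih]
    have h := coeff_succ_three ha b c d n
    push_cast
    linear_combination t⁻¹ ^ (n + 4) * h

theorem isBigO_inv_pow {j k : ℕ} (h : k ≤ j) :
    (fun t : ℝ => t⁻¹ ^ j) =O[atTop] fun t => t⁻¹ ^ k := by
  refine IsBigO.of_bound 1 ?_
  filter_upwards [eventually_ge_atTop 1] with t ht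
  have ht0 : 0 < t := by linarith
  rw [one_mul, Real.norm_of_nonneg (by positivity), Real.norm_of_nonneg (by positivity)]
  exact pow_le_pow_of_le_one (by positivity) (inv_le_one_of_one_le₀ ht) h

theorem residual_isBigO {a : ℝ} (ha : 0 < a) (b c d : ℝ) (n : ℕ) :
    residual a b c d n =O[atTop] fun t => t⁻¹ ^ (n + 1) := by
  have hp : ∀ (C : ℝ) (j : ℕ), n + 1 ≤ j →
      (fun t : ℝ => C * t⁻¹ ^ j) =O[atTop] fun t => t⁻¹ ^ (n + 1) :=
    fun C j hj => (isBigO_inv_pow hj).const_mul_left C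
  match n with
  | 0 =>
    refine (isBigO_zero _ _).congr_left fun t => ?_
    rw [residual_zero]
  | 1 =>
    refine (((hp ((1 - 2 * c) * (2 * c - 3) / 4 - 4 * b) 2 (by omega)).sub
      (hp (4 * d * √a) 3 (by omega))).add (hp (d * (1 - 2 * c)) 4 (by omega))).congr_left
      fun t => ?_
    rw [residual_succ, residual_zero, coeff]
    push_cast
    ring
  | n + 2 =>
    refine (((hp _ _ (by omega)).add (hp _ (n + 4) (by omega))).add
      (hp _ (n + 5) (by omega))).congr_left fun t => (residual_add_two ha b c d n t).symm

theorem potential_isBigO (a b c d : ℝ) :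
    potential a b c d =O[atTop] fun t => t⁻¹ ^ 2 :=
  (((isBigO_inv_pow le_rfl).const_mul_left _).sub
    ((isBigO_inv_pow (by omega)).const_mul_left _)).add
    ((isBigO_inv_pow (by omega)).const_mul_left _)

theorem continuousOn_potential (a b c d : ℝ) : ContinuousOn (potential a b c d) (Ioi 0) := by
  have h : ContinuousOn (fun t : ℝ => t⁻¹) (Ioi 0) := continuousOn_inv₀.mono fun t ht => ne_of_gt ht
  unfold potential
  fun_prop

theorem exists_potential_bound (a b c d : ℝ) {δ : ℝ} (hδ : 0 < δ) :
    ∃ M, ∀ t, δ ≤ t → |potential a b c d t| ≤ M * t⁻¹ ^ 2 := by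
  refine ⟨|(1 - 2 * c) * (2 * c - 3) / 4 - 4 * b| + |4 * d * √a| * δ⁻¹
    + |d * (1 - 2 * c)| * δ⁻¹ ^ 2, fun t ht => ?_⟩
  have ht0 : 0 < t := hδ.trans_le ht
  have h1 : potential a b c d t = (((1 - 2 * c) * (2 * c - 3) / 4 - 4 * b) - 4 * d * √a * t⁻¹
    + d * (1 - 2 * c) * t⁻¹ ^ 2) * t⁻¹ ^ 2 := by
    rw [potential]
    ring
  rw [h1, abs_mul, abs_of_pos (show 0 < t⁻¹ ^ 2 by positivity)]
  gcongr
  refine (abs_add_le _ _).trans (add_le_add ((abs_sub _ _).trans (add_le_add le_rfl ?_)) ?_)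
  · rw [abs_mul, abs_of_pos (show 0 < t⁻¹ by positivity)]
    gcongr
  · rw [abs_mul, abs_of_pos (show 0 < t⁻¹ ^ 2 by positivity)]
    gcongr

/-! ### The expansion of the amplitude -/

theorem isBigO_inv_pow_one {k : ℕ} :
    (fun t : ℝ => t⁻¹ ^ k) =O[atTop] fun _ => (1 : ℝ) := by
  simpa using isBigO_inv_pow (Nat.zero_le k)

/-- The amplitude and its derivative have the asymptotic expansions given by the formal series.
The error `e` of the partial sum satisfies `e'' = rate * e' - g * e - residual`; an error bound
`t ^ (-n)` makes the inhomogeneity of order `t ^ (-n - 2)`, hence also `e'`, and integration gives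
the error bound `t ^ (-n - 1)`. -/
theorem amplitude_expansion {a : ℝ} (ha : 0 < a) {b c d : ℝ} {w v : ℝ → ℝ}
    (hw : ∀ t, 0 < t → HasDerivAt w (v t) t)
    (hv : ∀ t, 0 < t → HasDerivAt v (rate (4 * √a) d t * v t - potential a b c d t * w t) t)
    (h1 : Tendsto w atTop (𝓝 1)) (hvb : v =O[atTop] fun _ => (1 : ℝ)) (n : ℕ) :
    (fun t => w t - partialSum (coeff a b c d) n t) =O[atTop] (fun t => t⁻¹ ^ n) ∧
    (fun t => v t - partialSumDeriv (coeff a b c d) n t) =O[atTop] (fun t => t⁻¹ ^ n) := by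
  have hβ : 0 < 4 * √a := by have := Real.sqrt_pos.2 ha; positivity
  set A := coeff a b c d with hA
  induction n with
  | zero =>
    simp only [partialSum, partialSumDeriv, Finset.range_zero, Finset.sum_empty, sub_zero, pow_zero]
    exact ⟨h1.isBigO_one ℝ, hvb⟩
  | succ n ih =>
    have he : (fun t => w t - partialSum A (n + 1) t) =O[atTop] fun t => t⁻¹ ^ n := by
      refine (ih.1.sub ((isBigO_refl _ _).const_mul_left (A n))).congr_left fun t => ?_
      simp only [partialSum, Finset.sum_range_succ]
      ring
    have hu1 : (fun t => v t - partialSumDeriv A (n + 1) t) =O[atTop] fun _ => (1 : ℝ) :=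
      hvb.sub (IsBigO.fun_sum fun k _ =>
        ((isBigO_inv_pow_one.const_mul_left (-(k : ℝ))).const_mul_left (A k)))
    have hu : (fun t => v t - partialSumDeriv A (n + 1) t) =O[atTop] fun t => t⁻¹ ^ (n + 2) := by
      refine isBigO_of_hasDerivAt_rate (d := d) hβ
        (h := fun t => -(potential a b c d t * (w t - partialSum A (n + 1) t))
          - residual a b c d (n + 1) t) (fun t ht => ?_) hu1 ?_
      · refine ((hv t ht).sub (hasDerivAt_partialSumDeriv A (n + 1) ht)).congr_deriv ?_
        rw [residual, ← hA]
        ring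
      · refine IsBigO.sub (IsBigO.neg_left ?_) (residual_isBigO ha b c d (n + 1))
        exact ((potential_isBigO a b c d).mul he).congr_right fun t => by ring
    refine ⟨isBigO_of_hasDerivAt_of_tendsto
      (fun t ht => (hw t ht).sub (hasDerivAt_partialSum A (n + 1) ht)) ?_ hu,
      hu.trans (isBigO_inv_pow (by omega))⟩
    have hS : Tendsto (partialSum A (n + 1)) atTop (𝓝 1) := by
      have h2 : Tendsto (partialSum A (n + 1)) atTop
          (𝓝 (∑ k ∈ Finset.range (n + 1), A k * if k = 0 then 1 else 0)) := by
        refine tendsto_finsetSum _ fun k _ => Tendsto.const_mul _ ?_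
        rcases eq_or_ne k 0 with rfl | hk
        · simp
        · simpa [hk] using tendsto_inv_pow_zero hk
      simpa [hA, coeff] using h2
    simpa using h1.sub hS

/-! ### From the amplitude to the solution -/

theorem scale_pos (a c s : ℝ) {x : ℝ} (hx : 0 < x) : 0 < scale a c s x :=
  mul_pos (Real.rpow_pos_of_pos hx _) (Real.exp_pos _)

theorem scale_add_natCast (a c s : ℝ) (k : ℕ) {x : ℝ} (hx : 0 < x) :
    scale a c (s + k) x = scale a c s x * (√x)⁻¹ ^ k := by
  have h : (√x)⁻¹ ^ k = x ^ (-(k : ℝ) / 2) := by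
    rw [Real.sqrt_eq_rpow, ← Real.rpow_neg hx.le, ← Real.rpow_natCast, ← Real.rpow_mul hx.le]
    congr 1
    ring
  rw [scale, scale, h, mul_right_comm, ← Real.rpow_add hx]
  congr 3
  ring

theorem scale_natCast (a c : ℝ) (k : ℕ) {x : ℝ} (hx : 0 < x) :
    scale a c k x = scale a c 0 x * (√x)⁻¹ ^ k := by
  rw [← scale_add_natCast a c 0 k hx, zero_add]

theorem hasDerivAt_scale {a : ℝ} (ha : 0 < a) (c s : ℝ) {x : ℝ} (hx : 0 < x) :
    HasDerivAt (scale a c s)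
      ((1 / 4 - c / 2 - s / 2) * scale a c (s + 2) x - √a * scale a c (s + 1) x) x := by
  have h1 := Real.hasDerivAt_rpow_const (p := 1 / 4 - c / 2 - s / 2) (Or.inl hx.ne')
  have h2 := (((Real.hasDerivAt_sqrt hx.ne').const_mul √a).const_mul (-2)).exp
  have h3 : scale a c s = fun x => x ^ (1 / 4 - c / 2 - s / 2) * Real.exp (-2 * (√a * √x)) := by
    funext x
    rw [scale, Real.sqrt_mul ha.le]
  have e1 := scale_add_natCast a c s 1 hx
  have e2 := scale_add_natCast a c s 2 hx
  push_cast at e1 e2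
  rw [e1, e2, h3]
  refine (h1.mul h2).congr_deriv ?_
  have hs : √x ≠ 0 := (Real.sqrt_pos.2 hx).ne'
  have hx2 : (√x)⁻¹ ^ 2 = x⁻¹ := by rw [inv_pow, Real.sq_sqrt hx.le]
  rw [Real.rpow_sub_one hx.ne', hx2]
  field_simp
  ring

/-- The function `x ↦ x ^ (1/4 - c/2) * exp (-2 √(a x)) * w (√x)` with amplitude `w`. -/
noncomputable def lift (a c : ℝ) (w : ℝ → ℝ) (x : ℝ) : ℝ := scale a c 0 x * w √x

/-- The amplitude of the derivative of `lift a c w`, where `v` is the derivative of `w`. -/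
noncomputable def ampDeriv (a c : ℝ) (w v : ℝ → ℝ) (t : ℝ) : ℝ :=
  ((1 / 4 - c / 2) * t⁻¹ ^ 2 - √a * t⁻¹) * w t + t⁻¹ / 2 * v t

theorem hasDerivAt_lift {a : ℝ} (ha : 0 < a) (c : ℝ) {w v : ℝ → ℝ}
    (hw : ∀ t, 0 < t → HasDerivAt w (v t) t) {x : ℝ} (hx : 0 < x) :
    HasDerivAt (lift a c w) (lift a c (ampDeriv a c w v) x) x := by
  have hs := Real.sqrt_pos.2 hx
  refine ((hasDerivAt_scale ha c 0 hx).mul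
    ((hw _ hs).comp x (Real.hasDerivAt_sqrt hx.ne'))).congr_deriv ?_
  have e1 := scale_add_natCast a c 0 1 hx
  have e2 := scale_add_natCast a c 0 2 hx
  push_cast at e1 e2
  rw [e1, e2, lift, ampDeriv, Function.comp_apply]
  field_simp
  ring

/-- The derivative of `ampDeriv a c w v`, where `z` is the derivative of `v`. -/
noncomputable def ampDerivDeriv (a c : ℝ) (w v z : ℝ → ℝ) (t : ℝ) : ℝ :=
  (-2 * (1 / 4 - c / 2) * t⁻¹ ^ 3 + √a * t⁻¹ ^ 2) * w t
    + ((1 / 4 - c / 2) * t⁻¹ ^ 2 - √a * t⁻¹) * v t - t⁻¹ ^ 2 / 2 * v t + t⁻¹ / 2 * z t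

theorem hasDerivAt_ampDeriv (a c : ℝ) {w v z : ℝ → ℝ}
    (hw : ∀ t, 0 < t → HasDerivAt w (v t) t) (hv : ∀ t, 0 < t → HasDerivAt v (z t) t)
    {t : ℝ} (ht : 0 < t) :
    HasDerivAt (ampDeriv a c w v) (ampDerivDeriv a c w v z t) t := by
  have h1 := hasDerivAt_inv_pow 1 ht
  simp only [pow_one] at h1
  refine (((((hasDerivAt_inv_pow 2 ht).const_mul (1 / 4 - c / 2)).sub (h1.const_mul √a)).mul
    (hw t ht)).add ((h1.div_const 2).mul (hv t ht))).congr_deriv ?_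
  simp only [ampDerivDeriv, Pi.sub_apply]
  push_cast
  ring

theorem hasDerivAt_deriv_lift {a : ℝ} (ha : 0 < a) (c : ℝ) {w v z : ℝ → ℝ}
    (hw : ∀ t, 0 < t → HasDerivAt w (v t) t) (hv : ∀ t, 0 < t → HasDerivAt v (z t) t)
    {x : ℝ} (hx : 0 < x) :
    HasDerivAt (deriv (lift a c w))
      (lift a c (ampDeriv a c (ampDeriv a c w v) (ampDerivDeriv a c w v z)) x) x := by
  refine (hasDerivAt_lift ha c (fun t ht => hasDerivAt_ampDeriv a c hw hv ht)
    hx).congr_of_eventuallyEq ?_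
  filter_upwards [Ioi_mem_nhds hx] with s hs using (hasDerivAt_lift ha c hw hs).deriv

/-- The equation for `y` becomes `w'' = rate * w' - potential * w` for its amplitude. -/
theorem operator_lift {a : ℝ} (ha : 0 < a) (b c d : ℝ) {w v z : ℝ → ℝ}
    (hw : ∀ t, 0 < t → HasDerivAt w (v t) t) (hv : ∀ t, 0 < t → HasDerivAt v (z t) t)
    {x : ℝ} (hx : 0 < x) :
    x ^ 2 * deriv (deriv (lift a c w)) x + (c * x + d) * deriv (lift a c w) x
        - (a * x + b) * lift a c w x =
      x / 4 * lift a c (fun t => z t - rate (4 * √a) d t * v t + potential a b c d t * w t) x := by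
  rw [(hasDerivAt_deriv_lift ha c hw hv hx).deriv, (hasDerivAt_lift ha c hw hx).deriv]
  simp only [lift, ampDeriv, ampDerivDeriv, rate, potential]
  obtain ⟨t, ht, rfl⟩ : ∃ t : ℝ, 0 < t ∧ x = t ^ 2 :=
    ⟨√x, Real.sqrt_pos.2 hx, (Real.sq_sqrt hx.le).symm⟩
  obtain ⟨s, hs, rfl⟩ : ∃ s : ℝ, 0 < s ∧ a = s ^ 2 :=
    ⟨√a, Real.sqrt_pos.2 ha, (Real.sq_sqrt ha.le).symm⟩
  rw [Real.sqrt_sq ht.le, Real.sqrt_sq hs.le]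
  generalize scale (s ^ 2) c 0 (t ^ 2) = σ
  field_simp
  ring

theorem lift_partialSum (a c : ℝ) (A : ℕ → ℝ) (n : ℕ) {x : ℝ} (hx : 0 < x) :
    lift a c (partialSum A n) x = ∑ k ∈ Finset.range n, A k * scale a c k x := by
  rw [lift, partialSum, Finset.mul_sum]
  refine Finset.sum_congr rfl fun k _ => ?_
  rw [scale_natCast a c k hx]
  ring

theorem lift_isBigO {a c : ℝ} {w : ℝ → ℝ} {n : ℕ} (hw : w =O[atTop] fun t => t⁻¹ ^ n) :
    lift a c w =O[atTop] scale a c n := by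
  have h := (isBigO_refl (scale a c 0) atTop).mul (hw.comp_tendsto Real.tendsto_sqrt_atTop)
  refine h.congr' EventuallyEq.rfl ?_
  filter_upwards [eventually_gt_atTop 0] with x hx using (scale_natCast a c n hx).symm

theorem hasExpansion_iff {a c : ℝ} {A : ℕ → ℝ} {y : ℝ → ℝ} :
    HasExpansion a c A y ↔ ∀ n : ℕ,
      (fun x => y x - ∑ k ∈ Finset.range n, A k * scale a c k x) =O[atTop] scale a c n := by
  have hsc : ∀ (k : ℕ) {x : ℝ}, 0 < x → scale a c k x =
      x ^ (1 / 4 - c / 2) * Real.exp (-2 * √(a * x)) * x ^ (-(k : ℝ) / 2) := by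
    intro k x hx
    rw [scale, mul_right_comm, ← Real.rpow_add hx]
    congr 3
    ring
  refine forall_congr' fun n => isBigO_congr ?_ ?_
  · filter_upwards [eventually_gt_atTop 0] with x hx
    rw [Finset.mul_sum]
    congr 1
    refine Finset.sum_congr rfl fun k _ => ?_
    rw [hsc k hx]
    ring
  · filter_upwards [eventually_gt_atTop 0] with x hx using (hsc n hx).symm

/-! ### Smoothness -/

theorem IsSolution.deriv_deriv {a b c d : ℝ} {y : ℝ → ℝ} (hy : IsSolution a b c d y) {x : ℝ}
    (hx : 0 < x) :
    deriv (deriv y) x = -(c * x⁻¹ + d * x⁻¹ ^ 2) * deriv y x + (a * x⁻¹ + b * x⁻¹ ^ 2) * y x := by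
  have h := (hy x hx).2.2
  field_simp
  linarith

theorem contDiffOn_inv_pow (k : ℕ) {n : WithTop ℕ∞} :
    ContDiffOn ℝ n (fun x : ℝ => x⁻¹ ^ k) (Ioi 0) :=
  (contDiffOn_id.inv fun _ hx => ne_of_gt hx).pow k

theorem IsSolution.contDiffOn {a b c d : ℝ} {y : ℝ → ℝ} (hy : IsSolution a b c d y) :
    ContDiffOn ℝ ∞ y (Ioi 0) := by
  have hi : ∀ {n : WithTop ℕ∞}, ContDiffOn ℝ n (fun x : ℝ => x⁻¹) (Ioi 0) := by
    intro n
    simpa using contDiffOn_inv_pow 1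
  have main : ∀ n : ℕ, ContDiffOn ℝ n y (Ioi 0) ∧ ContDiffOn ℝ n (deriv y) (Ioi 0) := by
    intro n
    induction n with
    | zero =>
      simp only [Nat.cast_zero, contDiffOn_zero]
      exact ⟨fun x hx => (hy x hx).1.continuousAt.continuousWithinAt,
        fun x hx => (hy x hx).2.1.continuousAt.continuousWithinAt⟩
    | succ n ih =>
      push_cast
      rw [contDiffOn_succ_iff_deriv_of_isOpen isOpen_Ioi,
        contDiffOn_succ_iff_deriv_of_isOpen isOpen_Ioi]
      refine ⟨⟨fun x hx => (hy x hx).1.differentiableWithinAt, by simp, ih.2⟩,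
        fun x hx => (hy x hx).2.1.differentiableWithinAt, by simp, ?_⟩
      refine ContDiffOn.congr ?_ fun x hx => hy.deriv_deriv hx
      exact (((contDiffOn_const.mul hi).add (contDiffOn_const.mul (hi.pow 2))).neg.mul ih.2).add
        (((contDiffOn_const.mul hi).add (contDiffOn_const.mul (hi.pow 2))).mul ih.1)
  exact contDiffOn_infty.2 fun n => (main n).1

theorem contDiffOn_scale {a : ℝ} (ha : 0 < a) (c s : ℝ) :
    ContDiffOn ℝ ∞ (scale a c s) (Ioi 0) := by
  have hs : ContDiffOn ℝ ∞ (fun x => √(a * x)) (Ioi 0) :=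
    ContDiffOn.sqrt (contDiffOn_const.mul contDiffOn_id) fun x hx => (mul_pos ha hx).ne'
  exact (contDiffOn_id.rpow_const_of_ne fun x hx => ne_of_gt hx).mul
    (Real.contDiff_exp.comp_contDiffOn (contDiffOn_const.mul hs))

/-! ### Differentiated expansions -/

/-- `f` is smooth on `(0, ∞)` and all its derivatives, including `f` itself, are `O(φ)` at
infinity. -/
def DerivsIsBigO (f φ : ℝ → ℝ) : Prop :=
  ContDiffOn ℝ ∞ f (Ioi 0) ∧ ∀ m, iteratedDeriv m f =O[atTop] φ

theorem contDiffAt_of_Ioi {f : ℝ → ℝ} (hf : ContDiffOn ℝ ∞ f (Ioi 0)) {x : ℝ} (hx : 0 < x)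
    (m : ℕ) : ContDiffAt ℝ m f x :=
  (hf.contDiffAt (Ioi_mem_nhds hx)).of_le (by exact_mod_cast le_top)

theorem iteratedDeriv_eventuallyEq_of_eqOn {f g : ℝ → ℝ} (h : EqOn f g (Ioi 0)) (m : ℕ) :
    iteratedDeriv m f =ᶠ[atTop] iteratedDeriv m g := by
  filter_upwards [eventually_gt_atTop 0] with x hx
    using h.iteratedDeriv_of_isOpen isOpen_Ioi m hx

namespace DerivsIsBigO

variable {f g φ : ℝ → ℝ}

theorem congr (hf : DerivsIsBigO f φ) (h : EqOn g f (Ioi 0)) : DerivsIsBigO g φ :=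
  ⟨hf.1.congr h, fun m => (hf.2 m).congr' (iteratedDeriv_eventuallyEq_of_eqOn h m).symm
    EventuallyEq.rfl⟩

theorem const_mul (hf : DerivsIsBigO f φ) (C : ℝ) : DerivsIsBigO (fun x => C * f x) φ := by
  refine ⟨contDiffOn_const.mul hf.1, fun m => ((hf.2 m).const_mul_left C).congr_left fun x => ?_⟩
  rw [iteratedDeriv_const_mul_field]

theorem add (hf : DerivsIsBigO f φ) (hg : DerivsIsBigO g φ) :
    DerivsIsBigO (fun x => f x + g x) φ := by
  refine ⟨hf.1.add hg.1, fun m => ((hf.2 m).add (hg.2 m)).congr' ?_ EventuallyEq.rfl⟩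
  filter_upwards [eventually_gt_atTop 0] with x hx
  rw [iteratedDeriv_fun_add (contDiffAt_of_Ioi hf.1 hx m) (contDiffAt_of_Ioi hg.1 hx m)]

end DerivsIsBigO

theorem iteratedDeriv_mul_isBigO {f g φ : ℝ → ℝ} {m : ℕ}
    (hf : DerivsIsBigO f fun _ => 1) (hg : ContDiffOn ℝ ∞ g (Ioi 0))
    (hgb : ∀ j ≤ m, iteratedDeriv j g =O[atTop] φ) :
    iteratedDeriv m (fun x => f x * g x) =O[atTop] φ := by
  have h : (fun x => ∑ i ∈ Finset.range (m + 1),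
      (m.choose i : ℝ) * iteratedDeriv i f x * iteratedDeriv (m - i) g x) =O[atTop] φ := by
    refine IsBigO.fun_sum fun i _ => ?_
    simpa using ((hf.2 i).const_mul_left _).mul (hgb (m - i) (by omega))
  refine h.congr' ?_ EventuallyEq.rfl
  filter_upwards [eventually_gt_atTop 0] with x hx
  rw [iteratedDeriv_fun_mul (contDiffAt_of_Ioi hf.1 hx m) (contDiffAt_of_Ioi hg hx m)]

/-- For a solution of `f'' = p f' + q f + r`, bounds for `f` and `f'` carry over to all
derivatives, provided that the coefficients have bounded derivatives. -/
theorem derivsIsBigO_of_ode {f p q r φ : ℝ → ℝ} (hf : ContDiffOn ℝ ∞ f (Ioi 0))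
    (hp : DerivsIsBigO p fun _ => 1) (hq : DerivsIsBigO q fun _ => 1) (hr : DerivsIsBigO r φ)
    (hode : ∀ x, 0 < x → deriv (deriv f) x = p x * deriv f x + q x * f x + r x)
    (h0 : f =O[atTop] φ) (h1 : deriv f =O[atTop] φ) : DerivsIsBigO f φ := by
  have hf' : ContDiffOn ℝ ∞ (deriv f) (Ioi 0) :=
    ((contDiffOn_infty_iff_deriv_of_isOpen isOpen_Ioi).1 hf).2
  refine ⟨hf, fun m => ?_⟩
  induction m using Nat.strong_induction_on with
  | _ m ih =>
    match m, ih with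
    | 0, _ => simpa using h0
    | 1, _ => simpa using h1
    | m + 2, ih =>
      have hE : EqOn (deriv (deriv f)) (fun x => (p x * deriv f x + q x * f x) + r x) (Ioi 0) :=
        fun x hx => hode x hx
      have hpf : ContDiffOn ℝ ∞ (fun x => p x * deriv f x) (Ioi 0) := hp.1.mul hf'
      have hqf : ContDiffOn ℝ ∞ (fun x => q x * f x) (Ioi 0) := hq.1.mul hf
      have b1 : iteratedDeriv m (fun x => p x * deriv f x) =O[atTop] φ :=
        iteratedDeriv_mul_isBigO hp hf' fun j hj => by
          rw [← iteratedDeriv_succ']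
          exact ih (j + 1) (by omega)
      have b2 : iteratedDeriv m (fun x => q x * f x) =O[atTop] φ :=
        iteratedDeriv_mul_isBigO hq hf fun j hj => ih j (by omega)
      rw [iteratedDeriv_succ', iteratedDeriv_succ']
      refine ((b1.add b2).add (hr.2 m)).congr' ?_ EventuallyEq.rfl
      filter_upwards [eventually_gt_atTop 0, iteratedDeriv_eventuallyEq_of_eqOn hE m] with x hx h
      rw [h, iteratedDeriv_fun_add ((contDiffAt_of_Ioi hpf hx m).add (contDiffAt_of_Ioi hqf hx m))
        (contDiffAt_of_Ioi hr.1 hx m),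
        iteratedDeriv_fun_add (contDiffAt_of_Ioi hpf hx m) (contDiffAt_of_Ioi hqf hx m)]

theorem derivsIsBigO_inv_pow (k : ℕ) : DerivsIsBigO (fun x : ℝ => x⁻¹ ^ k) fun _ => 1 := by
  refine ⟨contDiffOn_inv_pow k, fun m => ?_⟩
  induction m generalizing k with
  | zero => simpa using isBigO_inv_pow_one (k := k)
  | succ m ih =>
    have h : EqOn (deriv fun x : ℝ => x⁻¹ ^ k) (fun x => -(k : ℝ) * x⁻¹ ^ (k + 1)) (Ioi 0) :=
      fun x hx => (hasDerivAt_inv_pow k hx).deriv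
    rw [iteratedDeriv_succ']
    refine ((ih (k + 1)).const_mul_left (-(k : ℝ))).congr' ?_ EventuallyEq.rfl
    filter_upwards [iteratedDeriv_eventuallyEq_of_eqOn h m] with x hx
    rw [hx, iteratedDeriv_const_mul_field]

theorem scale_isBigO_scale {a c s s' : ℝ} (h : s' ≤ s) :
    scale a c s =O[atTop] scale a c s' := by
  refine IsBigO.of_bound 1 ?_
  filter_upwards [eventually_ge_atTop 1] with x hx
  have hx0 : 0 < x := by linarith
  rw [one_mul, Real.norm_of_nonneg (scale_pos a c s hx0).le,
    Real.norm_of_nonneg (scale_pos a c s' hx0).le, scale, scale]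
  gcongr

/-- Because of the factor `exp (-2 √(a x))`, each differentiation gains a factor `x ^ (-1/2)`. -/
theorem iteratedDeriv_scale_isBigO {a : ℝ} (ha : 0 < a) (c s : ℝ) (m : ℕ) :
    iteratedDeriv m (scale a c s) =O[atTop] scale a c (s + m) := by
  induction m generalizing s with
  | zero => simpa using isBigO_refl _ _
  | succ m ih =>
    have h : EqOn (deriv (scale a c s)) (fun x => (1 / 4 - c / 2 - s / 2) * scale a c (s + 2) x
        - √a * scale a c (s + 1) x) (Ioi 0) := fun x hx => (hasDerivAt_scale ha c s hx).deriv
    have b1 : iteratedDeriv m (scale a c (s + 2)) =O[atTop] scale a c (s + (m + 1 : ℕ)) :=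
      (ih (s + 2)).trans (scale_isBigO_scale (by push_cast; linarith))
    have b2 : iteratedDeriv m (scale a c (s + 1)) =O[atTop] scale a c (s + (m + 1 : ℕ)) :=
      (ih (s + 1)).trans (scale_isBigO_scale (by push_cast; linarith))
    have hc : ∀ (C s : ℝ), ContDiffOn ℝ ∞ (fun x => C * scale a c s x) (Ioi 0) := fun C s =>
      contDiffOn_const.mul (contDiffOn_scale ha c s)
    rw [iteratedDeriv_succ']
    refine ((b1.const_mul_left (1 / 4 - c / 2 - s / 2)).sub
      (b2.const_mul_left √a)).congr' ?_ EventuallyEq.rfl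
    filter_upwards [eventually_gt_atTop 0, iteratedDeriv_eventuallyEq_of_eqOn h m] with x hx h
    rw [h, iteratedDeriv_fun_sub (contDiffAt_of_Ioi (hc _ _) hx m)
      (contDiffAt_of_Ioi (hc _ _) hx m), iteratedDeriv_const_mul_field,
      iteratedDeriv_const_mul_field]

theorem derivsIsBigO_scale {a : ℝ} (ha : 0 < a) (c : ℝ) {s s' : ℝ} (h : s' ≤ s) :
    DerivsIsBigO (scale a c s) (scale a c s') :=
  ⟨contDiffOn_scale ha c s, fun m => (iteratedDeriv_scale_isBigO ha c s m).trans
    (scale_isBigO_scale (h.trans (le_add_of_nonneg_right m.cast_nonneg)))⟩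

/-- A crude bound for the derivatives of the error of a partial sum: differentiation does not
make the order worse. It is enough for the differentiated expansions, because the number of terms
can be increased. -/
theorem derivsIsBigO_error {a : ℝ} (ha : 0 < a) {b c d : ℝ} {w v : ℝ → ℝ}
    (hw : ∀ t, 0 < t → HasDerivAt w (v t) t)
    (hv : ∀ t, 0 < t → HasDerivAt v (rate (4 * √a) d t * v t - potential a b c d t * w t) t)
    (h1 : Tendsto w atTop (𝓝 1)) (hvb : v =O[atTop] fun _ => (1 : ℝ))
    (hy : IsSolution a b c d (lift a c w)) (n : ℕ) :
    DerivsIsBigO (fun x => lift a c w x -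
      ∑ k ∈ Finset.range (n + 2), coeff a b c d k * scale a c k x)
      (scale a c ((n + 2 : ℕ) : ℝ)) := by
  set A := coeff a b c d with hA
  set S := partialSum A (n + 2) with hS
  set S1 := partialSumDeriv A (n + 2) with hS1
  set S2 := partialSumDeriv2 A (n + 2) with hS2
  set z : ℝ → ℝ := fun t => rate (4 * √a) d t * v t - potential a b c d t * w t with hz
  obtain ⟨he, he'⟩ := amplitude_expansion ha hw hv h1 hvb (n + 2)
  rw [← hA, ← hS] at he
  rw [← hA, ← hS1] at he'
  have hdw : ∀ t, 0 < t → HasDerivAt (fun t => w t - S t) (v t - S1 t) t := fun t ht =>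
    (hw t ht).sub (hasDerivAt_partialSum A (n + 2) ht)
  have hdv : ∀ t, 0 < t → HasDerivAt (fun t => v t - S1 t) (z t - S2 t) t := fun t ht =>
    (hv t ht).sub (hasDerivAt_partialSumDeriv A (n + 2) ht)
  set f := lift a c fun t => w t - S t with hf
  have hsm : ContDiffOn ℝ ∞ f (Ioi 0) := by
    have h : ContDiffOn ℝ ∞ (fun x => lift a c w x - ∑ k ∈ Finset.range (n + 2),
        A k * scale a c k x) (Ioi 0) :=
      hy.contDiffOn.sub (ContDiffOn.sum fun k _ =>
        contDiffOn_const.mul (contDiffOn_scale ha c k))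
    refine h.congr fun x hx => ?_
    rw [← lift_partialSum a c A (n + 2) hx, hf]
    simp only [lift]
    ring
  have hone : DerivsIsBigO (fun x : ℝ => x⁻¹) fun _ => 1 := by
    simpa using derivsIsBigO_inv_pow 1
  have hp := ((hone.const_mul c).add ((derivsIsBigO_inv_pow 2).const_mul d)).const_mul (-1)
  have hq := (hone.const_mul a).add ((derivsIsBigO_inv_pow 2).const_mul b)
  -- The three powers that remain in the residual.
  have hr : DerivsIsBigO (fun x => 1 / 4 * (4 * √a * (n + 2) * A (n + 2))
        * scale a c (n + 2 + 3 : ℕ) x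
      + -1 / 4 * (-4 * d * √a * A (n + 1) + d * (1 - 2 * c - 2 * n) * A n)
        * scale a c (n + 2 + 4 : ℕ) x
      + -1 / 4 * (d * (1 - 2 * c - 2 * (n + 1)) * A (n + 1)) * scale a c (n + 2 + 5 : ℕ) x)
      (scale a c ((n + 2 : ℕ) : ℝ)) :=
    (((derivsIsBigO_scale ha c (by push_cast; linarith)).const_mul _).add
      ((derivsIsBigO_scale ha c (by push_cast; linarith)).const_mul _)).add
      ((derivsIsBigO_scale ha c (by push_cast; linarith)).const_mul _)
  have hmain : DerivsIsBigO f (scale a c ((n + 2 : ℕ) : ℝ)) := by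
    refine derivsIsBigO_of_ode hsm hp hq hr (fun x hx => ?_) (lift_isBigO he) ?_
    · have hop := operator_lift ha b c d hdw hdv hx
      have hres : ∀ t, (z t - S2 t) - rate (4 * √a) d t * (v t - S1 t)
          + potential a b c d t * (w t - S t) = -residual a b c d (n + 2) t := by
        intro t
        rw [residual, ← hA, ← hS, ← hS1, ← hS2, hz]
        ring
      simp only [hres, residual_add_two ha, ← hf] at hop
      rw [lift, ← hA] at hop
      rw [scale_natCast a c _ hx, scale_natCast a c _ hx, scale_natCast a c _ hx]
      have hx2 : (√x)⁻¹ ^ 2 = x⁻¹ := by rw [inv_pow, Real.sq_sqrt hx.le]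
      have hpow : ∀ j, (√x)⁻¹ ^ (n + 2 + j) = x⁻¹ * (√x)⁻¹ ^ (n + j) := by
        intro j
        rw [← hx2]
        ring
      rw [hpow, hpow, hpow]
      generalize (√x)⁻¹ ^ (n + 3) = τ3 at *
      generalize (√x)⁻¹ ^ (n + 4) = τ4 at *
      generalize (√x)⁻¹ ^ (n + 5) = τ5 at *
      field_simp
      linear_combination 4 * hop
    · have hamp : ampDeriv a c (fun t => w t - S t) (fun t => v t - S1 t)
          =O[atTop] fun t => t⁻¹ ^ (n + 2) := by
        have hb1 : (fun t : ℝ => t⁻¹) =O[atTop] fun _ => (1 : ℝ) := by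
          simpa using isBigO_inv_pow_one (k := 1)
        have hc1 := ((isBigO_inv_pow_one (k := 2)).const_mul_left (1 / 4 - c / 2)).sub
          (hb1.const_mul_left √a)
        have hc2 : (fun t : ℝ => t⁻¹ / 2) =O[atTop] fun _ => (1 : ℝ) :=
          (hb1.const_mul_left (1 / 2)).congr_left fun t => by ring
        exact ((hc1.mul he).add (hc2.mul he')).congr (fun t => rfl) fun t => one_mul _
      refine (lift_isBigO hamp).congr' ?_ EventuallyEq.rfl
      filter_upwards [eventually_gt_atTop 0] with x hx
        using (hasDerivAt_lift ha c hdw hx).deriv.symm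
  refine hmain.congr fun x hx => ?_
  rw [← lift_partialSum a c A (n + 2) hx, hf]
  simp only [lift]
  ring

theorem hasDifferentiatedExpansions_lift {a : ℝ} (ha : 0 < a) {b c d : ℝ} {w v : ℝ → ℝ}
    (hw : ∀ t, 0 < t → HasDerivAt w (v t) t)
    (hv : ∀ t, 0 < t → HasDerivAt v (rate (4 * √a) d t * v t - potential a b c d t * w t) t)
    (h1 : Tendsto w atTop (𝓝 1)) (hvb : v =O[atTop] fun _ => (1 : ℝ))
    (hy : IsSolution a b c d (lift a c w)) :
    HasDifferentiatedExpansions a c (coeff a b c d) (lift a c w) := by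
  intro m n
  set A := coeff a b c d with hA
  have h := (derivsIsBigO_error ha hw hv h1 hvb hy (n + m)).2 m
  rw [← hA] at h
  have hb : (fun x => ∑ k ∈ Finset.Ico n (n + m + 2), A k * iteratedDeriv m (scale a c k) x)
      =O[atTop] scale a c (n + m) := by
    refine IsBigO.fun_sum fun k hk => ((iteratedDeriv_scale_isBigO ha c k m).trans
      (scale_isBigO_scale ?_)).const_mul_left (A k)
    have : (n : ℝ) ≤ k := by exact_mod_cast (Finset.mem_Ico.1 hk).1
    linarith
  refine ((h.trans (scale_isBigO_scale (by push_cast; linarith))).add hb).congr' ?_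
    EventuallyEq.rfl
  filter_upwards [eventually_gt_atTop 0] with x hx
  have hc : ∀ k ∈ Finset.range (n + m + 2),
      ContDiffAt ℝ m (fun x => A k * scale a c (k : ℝ) x) x := fun k _ =>
    contDiffAt_of_Ioi (contDiffOn_const.mul (contDiffOn_scale ha c k)) hx m
  rw [iteratedDeriv_fun_sub (contDiffAt_of_Ioi hy.contDiffOn hx m) (ContDiffAt.sum hc),
    iteratedDeriv_fun_sum hc]
  simp only [iteratedDeriv_const_mul_field]
  rw [← Finset.sum_range_add_sum_Ico _ (show n ≤ n + m + 2 by omega)]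
  ring

/-! ### Uniqueness and monotonicity -/

/-- The integrating factor `x ^ c * exp (-d / x)`, which brings the equation into self-adjoint
form; it is the reciprocal of the Wronskian of two solutions, up to a constant. -/
noncomputable def liouvilleFactor (c d x : ℝ) : ℝ := x ^ c * Real.exp (-d * x⁻¹)

theorem liouvilleFactor_pos (c d : ℝ) {x : ℝ} (hx : 0 < x) : 0 < liouvilleFactor c d x :=
  mul_pos (Real.rpow_pos_of_pos hx _) (Real.exp_pos _)

theorem hasDerivAt_liouvilleFactor (c d : ℝ) {x : ℝ} (hx : 0 < x) :
    HasDerivAt (liouvilleFactor c d) ((c * x⁻¹ + d * x⁻¹ ^ 2) * liouvilleFactor c d x) x := by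
  refine ((Real.hasDerivAt_rpow_const (p := c) (Or.inl hx.ne')).mul
    ((hasDerivAt_inv hx.ne').const_mul (-d)).exp).congr_deriv ?_
  rw [liouvilleFactor, Real.rpow_sub_one hx.ne']
  field_simp

section Solutions

variable {a b c d : ℝ} {y z : ℝ → ℝ}

theorem IsSolution.hasDerivAt (hy : IsSolution a b c d y) {x : ℝ} (hx : 0 < x) :
    HasDerivAt y (deriv y x) x := (hy x hx).1.hasDerivAt

theorem IsSolution.hasDerivAt_deriv (hy : IsSolution a b c d y) {x : ℝ} (hx : 0 < x) :
    HasDerivAt (deriv y)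
      (-(c * x⁻¹ + d * x⁻¹ ^ 2) * deriv y x + (a * x⁻¹ + b * x⁻¹ ^ 2) * y x) x :=
  (hy x hx).2.1.hasDerivAt.congr_deriv (hy.deriv_deriv hx)

theorem IsSolution.sub (hy : IsSolution a b c d y) (hz : IsSolution a b c d z) :
    IsSolution a b c d (fun x => y x - z x) := by
  intro x hx
  have h1 : ∀ x, 0 < x → HasDerivAt (fun x => y x - z x) (deriv y x - deriv z x) x :=
    fun x hx => (hy.hasDerivAt hx).sub (hz.hasDerivAt hx)
  have h2 : HasDerivAt (deriv fun x => y x - z x) (deriv (deriv y) x - deriv (deriv z) x) x := by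
    refine ((hy x hx).2.1.hasDerivAt.sub (hz x hx).2.1.hasDerivAt).congr_of_eventuallyEq ?_
    filter_upwards [Ioi_mem_nhds hx] with s hs using (h1 s hs).deriv
  refine ⟨(h1 x hx).differentiableAt, h2.differentiableAt, ?_⟩
  rw [h2.deriv, (h1 x hx).deriv]
  linear_combination (hy x hx).2.2 - (hz x hx).2.2

/-- A solution that vanishes near infinity vanishes: for a suitable `K`, the function
`(z ^ 2 + z' ^ 2) * exp (K x)` is increasing on a given compact interval. -/
theorem IsSolution.eqOn_zero_of_eventually (hz : IsSolution a b c d z) {T : ℝ}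
    (hT : ∀ x, T ≤ x → z x = 0) : EqOn z 0 (Ioi 0) := by
  intro x hx
  have hx : 0 < x := hx
  set X := max x T + 1 with hX
  have hxX : x ≤ X := by have := le_max_left x T; linarith
  have hTX : T < X := by have := le_max_right x T; linarith
  have hzX : z X = 0 := hT X hTX.le
  have hzX' : deriv z X = 0 := by
    have : z =ᶠ[𝓝 X] fun _ => 0 := by
      filter_upwards [Ioi_mem_nhds hTX] with s hs using hT s (le_of_lt hs)
    rw [this.deriv_eq, deriv_const]
  set P := |c| * x⁻¹ + |d| * x⁻¹ ^ 2 with hP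
  set Q := |a| * x⁻¹ + |b| * x⁻¹ ^ 2 with hQ
  set K := 1 + 2 * P + Q with hK
  have hder : ∀ s, 0 < s → HasDerivAt (fun s => (z s ^ 2 + deriv z s ^ 2) * Real.exp (K * s))
      ((2 * z s * deriv z s + 2 * deriv z s * (-(c * s⁻¹ + d * s⁻¹ ^ 2) * deriv z s
        + (a * s⁻¹ + b * s⁻¹ ^ 2) * z s) + K * (z s ^ 2 + deriv z s ^ 2)) * Real.exp (K * s)) s := by
    intro s hs
    refine ((((hz.hasDerivAt hs).fun_pow 2).add ((hz.hasDerivAt_deriv hs).fun_pow 2)).mul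
      ((hasDerivAt_id s).const_mul K).exp).congr_deriv ?_
    simp only [Pi.add_apply, id]
    push_cast
    ring
  have hbd : ∀ (p q : ℝ) {s : ℝ}, x ≤ s →
      |p * s⁻¹ + q * s⁻¹ ^ 2| ≤ |p| * x⁻¹ + |q| * x⁻¹ ^ 2 := by
    intro p q s hs
    have hs0 : 0 < s := hx.trans_le hs
    refine (abs_add_le _ _).trans ?_
    rw [abs_mul, abs_mul, abs_of_pos (show 0 < s⁻¹ by positivity),
      abs_of_pos (show 0 < s⁻¹ ^ 2 by positivity)]
    gcongr
  have hmono : MonotoneOn (fun s => (z s ^ 2 + deriv z s ^ 2) * Real.exp (K * s)) (Icc x X) := by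
    refine monotoneOn_of_deriv_nonneg (convex_Icc x X)
      (fun s hs => (hder s (hx.trans_le hs.1)).continuousAt.continuousWithinAt)
      (fun s hs => ?_) (fun s hs => ?_)
    all_goals rw [interior_Icc] at hs
    · exact (hder s (hx.trans hs.1)).differentiableAt.differentiableWithinAt
    · rw [(hder s (hx.trans hs.1)).deriv]
      refine mul_nonneg ?_ (Real.exp_pos _).le
      have h1 := hbd c d hs.1.le
      have h2 := hbd a b hs.1.le
      rw [← hP] at h1
      rw [← hQ] at h2
      generalize c * s⁻¹ + d * s⁻¹ ^ 2 = p at *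
      generalize a * s⁻¹ + b * s⁻¹ ^ 2 = q at *
      generalize z s = u at *
      generalize deriv z s = v at *
      rw [abs_le] at h1 h2
      have e1 : 0 ≤ (P - p) * v ^ 2 := mul_nonneg (by linarith) (sq_nonneg _)
      have e2 : 0 ≤ (Q + q) * (u + v) ^ 2 := mul_nonneg (by linarith) (sq_nonneg _)
      have e3 : 0 ≤ (Q - q) * (u - v) ^ 2 := mul_nonneg (by linarith) (sq_nonneg _)
      have e4 : 0 ≤ P * u ^ 2 := mul_nonneg (by linarith) (sq_nonneg _)
      rw [hK]
      nlinarith [sq_nonneg (u + v)]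
  have h := hmono (left_mem_Icc.2 hxX) (right_mem_Icc.2 hxX) hxX
  simp only [hzX, hzX'] at h
  have h2 : z x ^ 2 + deriv z x ^ 2 ≤ 0 := by
    refine nonpos_of_mul_nonpos_left (h.trans (by simp)) (Real.exp_pos _)
  have : z x ^ 2 = 0 := by nlinarith [sq_nonneg (z x), sq_nonneg (deriv z x)]
  simpa using this

/-- Abel's identity for the Wronskian. -/
theorem IsSolution.exists_wronskian_eq (hy : IsSolution a b c d y) (hz : IsSolution a b c d z) :
    ∃ C, ∀ x, 0 < x → (y x * deriv z x - z x * deriv y x) * liouvilleFactor c d x = C := by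
  refine ⟨(y 1 * deriv z 1 - z 1 * deriv y 1) * liouvilleFactor c d 1, fun x hx => ?_⟩
  have hder : ∀ x, 0 < x → HasDerivAt
      (fun x => (y x * deriv z x - z x * deriv y x) * liouvilleFactor c d x) 0 x := by
    intro x hx
    refine ((((hy.hasDerivAt hx).mul (hz.hasDerivAt_deriv hx)).sub
      ((hz.hasDerivAt hx).mul (hy.hasDerivAt_deriv hx))).mul
      (hasDerivAt_liouvilleFactor c d hx)).congr_deriv ?_
    simp only [Pi.sub_apply, Pi.mul_apply]
    ring
  exact isOpen_Ioi.is_const_of_deriv_eq_zero isPreconnected_Ioi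
    (fun s hs => (hder s hs).differentiableAt.differentiableWithinAt)
    (fun s hs => (hder s hs).deriv) hx (mem_Ioi.2 one_pos)

/-- The function `x ^ (1/2) * exp (-4 √(a x)) * exp (-d / x)`, which is `liouvilleFactor` times
the square of the leading term, tends to zero. -/
theorem tendsto_scale_sq_mul_liouvilleFactor (ha : 0 < a) (c d : ℝ) :
    Tendsto (fun x => scale a c 0 x ^ 2 * liouvilleFactor c d x) atTop (𝓝 0) := by
  have h1 : Tendsto (fun x : ℝ => √x * Real.exp (-(4 * √a) * √x)) atTop (𝓝 0) := by
    have h := Real.tendsto_pow_mul_exp_neg_atTop_nhds_zero 1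
    have hs : 0 < 4 * √a := by have := Real.sqrt_pos.2 ha; positivity
    have h2 := (h.comp (Real.tendsto_sqrt_atTop.const_mul_atTop hs)).const_mul (4 * √a)⁻¹
    rw [mul_zero] at h2
    refine h2.congr fun x => ?_
    simp only [Function.comp_apply]
    field_simp
  have h3 : Tendsto (fun x : ℝ => Real.exp (-d * x⁻¹)) atTop (𝓝 1) := by
    have h := (Real.continuous_exp.tendsto _).comp (tendsto_inv_atTop_zero.const_mul (-d))
    simpa [Function.comp_def] using h
  have h := h1.mul h3
  rw [zero_mul] at h
  refine h.congr' ?_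
  filter_upwards [eventually_gt_atTop 0] with x hx
  rw [scale, liouvilleFactor, mul_pow, ← Real.exp_nat_mul, ← Real.rpow_natCast,
    ← Real.rpow_mul hx.le, Real.sqrt_mul ha.le, Real.sqrt_eq_rpow x]
  have e1 : x ^ (1 / 2 : ℝ) = x ^ ((1 / 4 - c / 2 - 0 / 2) * ((2 : ℕ) : ℝ)) * x ^ c := by
    rw [← Real.rpow_add hx]
    congr 1
    push_cast
    ring
  have e2 : -(4 * √a) * x ^ (1 / 2 : ℝ) = ((2 : ℕ) : ℝ) * (-2 * (√a * x ^ (1 / 2 : ℝ))) := by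
    push_cast
    ring
  rw [e2]
  nth_rewrite 1 [e1]
  ring

/-- A differentiable function with a limit at infinity cannot have a derivative that is bounded
below by a positive constant. -/
theorem not_tendsto_of_le_hasDerivAt {q q' : ℝ → ℝ} {T C l : ℝ} (hC : 0 < C)
    (hq : ∀ x, T ≤ x → HasDerivAt q (q' x) x) (hq' : ∀ x, T ≤ x → C ≤ q' x) :
    ¬Tendsto q atTop (𝓝 l) := by
  intro h
  have hm : ∀ x, T ≤ x → C * (x - T) ≤ q x - q T := fun x hx =>
    (convex_Ici T).mul_sub_le_image_sub_of_le_deriv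
      (fun s hs => (hq s hs).continuousAt.continuousWithinAt)
      (fun s hs => (hq s (interior_subset hs)).differentiableAt.differentiableWithinAt)
      (fun s hs => by
        rw [(hq s (interior_subset hs)).deriv]
        exact hq' s (interior_subset hs)) T self_mem_Ici x hx hx
  have htop : Tendsto (fun x => C * (x - T) + q T) atTop atTop :=
    tendsto_atTop_add_const_right _ _
      ((tendsto_atTop_add_const_right _ (-T) tendsto_id).const_mul_atTop hC)
  refine not_tendsto_nhds_of_tendsto_atTop (tendsto_atTop_mono' _ ?_ htop) l h
  filter_upwards [eventually_ge_atTop T] with x hx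
  linarith [hm x hx]

/-- Two solutions, one of which is of the exact order of the leading term and the other one of
smaller order: the latter vanishes. Otherwise their quotient would have a derivative that tends to
infinity, by Abel's identity. -/
theorem IsSolution.eqOn_zero_of_isLittleO (ha : 0 < a) (hy : IsSolution a b c d y)
    (hz : IsSolution a b c d z) (hy0 : ∀ᶠ x in atTop, 0 < y x)
    (hyb : y =O[atTop] scale a c 0) (hzy : z =o[atTop] y) : EqOn z 0 (Ioi 0) := by
  obtain ⟨C, hC⟩ := hy.exists_wronskian_eq hz
  have hq0 : Tendsto (fun x => z x / y x) atTop (𝓝 0) := hzy.tendsto_div_nhds_zero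
  have hsmall : Tendsto (fun x => y x ^ 2 * liouvilleFactor c d x) atTop (𝓝 0) := by
    have h := (hyb.pow 2).mul (isBigO_refl (liouvilleFactor c d) atTop)
    exact h.trans_tendsto (tendsto_scale_sq_mul_liouvilleFactor ha c d)
  obtain ⟨T, hT⟩ := eventually_atTop.1 ((hy0.and (eventually_gt_atTop 0)).and
    (hsmall.eventually (Iio_mem_nhds one_pos)))
  have hq : ∀ x, T ≤ x → HasDerivAt (fun x => z x / y x)
      (C / (y x ^ 2 * liouvilleFactor c d x)) x := by
    intro x hx
    obtain ⟨⟨h1, h2⟩, h3⟩ := hT x hx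
    refine ((hz.hasDerivAt h2).div (hy.hasDerivAt h2) h1.ne').congr_deriv ?_
    have := liouvilleFactor_pos c d h2
    rw [← hC x h2]
    field_simp
  have hpos : ∀ x, T ≤ x → 0 < y x ^ 2 * liouvilleFactor c d x := fun x hx =>
    mul_pos (pow_pos (hT x hx).1.1 2) (liouvilleFactor_pos c d (hT x hx).1.2)
  have hbig : ∀ D : ℝ, 0 < D → ∀ x, T ≤ x → D ≤ D / (y x ^ 2 * liouvilleFactor c d x) :=
    fun D hD x hx => le_div_self hD.le (hpos x hx) (le_of_lt (hT x hx).2)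
  have hC0 : C = 0 := by
    rcases lt_trichotomy C 0 with h | h | h
    · refine absurd hq0.neg (not_tendsto_of_le_hasDerivAt (T := T) (neg_pos.2 h)
        (fun x hx => ((hq x hx).fun_neg).congr_deriv (neg_div _ _).symm)
        (hbig (-C) (neg_pos.2 h)))
    · exact h
    · exact absurd hq0 (not_tendsto_of_le_hasDerivAt h hq (hbig C h))
  simp only [hC0, zero_div] at hq
  refine hz.eqOn_zero_of_eventually (T := T) fun x hx => ?_
  have h1 := nonpos_of_hasDerivAt_nonneg_of_tendsto hq (fun _ _ => le_rfl) hq0 hx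
  have h2 := nonpos_of_hasDerivAt_nonneg_of_tendsto (fun x hx => (hq x hx).fun_neg)
    (fun _ _ => by simp) (by simpa using hq0.neg) hx
  have h3 : z x / y x = 0 := le_antisymm h1 (by linarith)
  rcases div_eq_zero_iff.1 h3 with h | h
  · exact h
  · exact absurd h (hT x hx).1.1.ne'

/-- For `b ≥ 0`, a solution that is positive and decreasing near infinity is so on `(0, ∞)`:
`liouvilleFactor * y * y'` is nondecreasing, so that it remains negative to the left. -/
theorem IsSolution.pos_and_strictAntiOn (ha : 0 < a) (hb : 0 ≤ b) (hy : IsSolution a b c d y)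
    (h : ∀ᶠ x in atTop, 0 < y x ∧ deriv y x < 0) :
    (∀ x, 0 < x → 0 < y x) ∧ StrictAntiOn y (Ioi 0) := by
  obtain ⟨T, hT⟩ := eventually_atTop.1 h
  have hder : ∀ x, 0 < x → HasDerivAt (fun x => y x * deriv y x * liouvilleFactor c d x)
      ((deriv y x ^ 2 + (a * x⁻¹ + b * x⁻¹ ^ 2) * y x ^ 2) * liouvilleFactor c d x) x := by
    intro x hx
    refine (((hy.hasDerivAt hx).mul (hy.hasDerivAt_deriv hx)).mul
      (hasDerivAt_liouvilleFactor c d hx)).congr_deriv ?_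
    simp only [Pi.mul_apply]
    ring
  have hmono : MonotoneOn (fun x => y x * deriv y x * liouvilleFactor c d x) (Ioi 0) := by
    refine monotoneOn_of_deriv_nonneg (convex_Ioi 0)
      (fun s hs => (hder s hs).continuousAt.continuousWithinAt)
      (fun s hs => (hder s (interior_subset hs)).differentiableAt.differentiableWithinAt)
      (fun s hs => ?_)
    have hs : 0 < s := interior_subset hs
    have := liouvilleFactor_pos c d hs
    rw [(hder s hs).deriv]
    positivity
  have hneg : ∀ x, 0 < x → y x * deriv y x < 0 := by
    intro x hx
    obtain ⟨h1, h2⟩ := hT (max x T) (le_max_right _ _)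
    have hX : 0 < max x T := lt_max_of_lt_left hx
    have h3 := hmono (mem_Ioi.2 hx) (mem_Ioi.2 hX) (le_max_left x T)
    have h4 := mul_neg_of_neg_of_pos (mul_neg_of_pos_of_neg h1 h2) (liouvilleFactor_pos c d hX)
    exact neg_of_mul_neg_left (h3.trans_lt h4) (liouvilleFactor_pos c d hx).le
  have hpos : ∀ x, 0 < x → 0 < y x := by
    intro x hx
    by_contra hle
    have hX : 0 < max x T := lt_max_of_lt_left hx
    have hc : ContinuousOn y (Icc x (max x T)) := fun s hs =>
      (hy.hasDerivAt (hx.trans_le hs.1)).continuousAt.continuousWithinAt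
    obtain ⟨s, hs, hs0⟩ := intermediate_value_Icc (le_max_left x T) hc
      ⟨not_lt.1 hle, (hT (max x T) (le_max_right _ _)).1.le⟩
    have := hneg s (hx.trans_le hs.1)
    rw [hs0, zero_mul] at this
    exact lt_irrefl _ this
  refine ⟨hpos, strictAntiOn_of_deriv_neg (convex_Ioi 0)
    (fun s hs => (hy.hasDerivAt hs).continuousAt.continuousWithinAt) fun s hs => ?_⟩
  have hs : 0 < s := interior_subset hs
  exact neg_of_mul_neg_right (hneg s hs) (hpos s hs).le

end Solutions

end DoublyConfluentHeun

theorem mainTheorem1 (a b c d : ℝ) (ha : 0 < a) :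
    ∃ y₂ : ℝ → ℝ,
      DoublyConfluentHeun.IsSolution a b c d y₂ ∧
      DoublyConfluentHeun.HasExpansion a c (DoublyConfluentHeun.coeff a b c d) y₂ ∧
      (∀ y : ℝ → ℝ, DoublyConfluentHeun.IsSolution a b c d y →
        DoublyConfluentHeun.HasExpansion a c (DoublyConfluentHeun.coeff a b c d) y →
        Set.EqOn y y₂ (Set.Ioi 0)) ∧
      ContDiffOn ℝ ∞ y₂ (Set.Ioi 0) ∧
      DoublyConfluentHeun.HasDifferentiatedExpansions a c
        (DoublyConfluentHeun.coeff a b c d) y₂ ∧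
      (0 ≤ b → (∀ x : ℝ, 0 < x → 0 < y₂ x) ∧ StrictAntiOn y₂ (Set.Ioi 0)) := by
  open DoublyConfluentHeun in
  have hs : 0 < √a := Real.sqrt_pos.2 ha
  obtain ⟨w, v, hw, hv, h1, hvb⟩ := exists_amplitude (d := d) (show 0 < 4 * √a by positivity)
    (continuousOn_potential a b c d) (fun δ hδ => exists_potential_bound a b c d hδ)
  have hy : IsSolution a b c d (lift a c w) := fun x hx => by
    refine ⟨(hasDerivAt_lift ha c hw hx).differentiableAt,
      (hasDerivAt_deriv_lift ha c hw hv hx).differentiableAt, ?_⟩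
    rw [operator_lift ha b c d hw hv hx]
    simp [lift]
  have hexp : HasExpansion a c (coeff a b c d) (lift a c w) := by
    refine hasExpansion_iff.2 fun n => ?_
    refine (lift_isBigO (amplitude_expansion ha hw hv h1 hvb n).1).congr' ?_ EventuallyEq.rfl
    filter_upwards [eventually_gt_atTop 0] with x hx
    rw [← lift_partialSum a c _ n hx]
    simp only [lift]
    ring
  have hsqrt := Real.tendsto_sqrt_atTop
  have hw2 : ∀ᶠ x : ℝ in atTop, 1 / 2 < w √x :=
    (h1.comp hsqrt).eventually (Ioi_mem_nhds (by norm_num))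
  have hpos : ∀ᶠ x in atTop, 0 < lift a c w x := by
    filter_upwards [hw2, eventually_gt_atTop 0] with x hx hx0
    exact mul_pos (scale_pos a c 0 hx0) (by linarith)
  refine ⟨lift a c w, hy, hexp, fun y hy' hexp' => ?_, hy.contDiffOn,
    hasDifferentiatedExpansions_lift ha hw hv h1 hvb hy, fun hb => ?_⟩
  · have hyb : lift a c w =O[atTop] scale a c 0 := by
      simpa using hasExpansion_iff.1 hexp 0
    have hlow : scale a c 0 =O[atTop] lift a c w := by
      refine IsBigO.of_bound 2 ?_
      filter_upwards [hw2, eventually_gt_atTop 0] with x hx hx0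
      have h0 := scale_pos a c 0 hx0
      rw [Real.norm_of_nonneg h0.le, lift, Real.norm_of_nonneg (by positivity)]
      nlinarith
    have hz : (fun x => y x - lift a c w x) =O[atTop] scale a c (1 : ℕ) :=
      ((hasExpansion_iff.1 hexp' 1).sub (hasExpansion_iff.1 hexp 1)).congr_left fun x => by ring
    have hlit : scale a c (1 : ℕ) =o[atTop] scale a c 0 := by
      have h := (isBigO_refl (scale a c 0) atTop).mul_isLittleO
        ((isLittleO_one_iff ℝ).2 (tendsto_inv_atTop_zero.comp hsqrt))
      refine h.congr' ?_ (Eventually.of_forall fun x => mul_one _)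
      filter_upwards [eventually_gt_atTop 0] with x hx
      rw [scale_natCast a c 1 hx, pow_one, Function.comp_apply]
    intro x hx
    exact sub_eq_zero.1 (hy.eqOn_zero_of_isLittleO ha (hy'.sub hy) hpos hyb
      ((hz.trans_isLittleO hlit).trans_isBigO hlow) hx)
  · refine hy.pos_and_strictAntiOn ha hb (hpos.and ?_)
    -- The amplitude of `y'`, multiplied by `t`, tends to `-√a`.
    have hlim : Tendsto (fun t => ((1 / 4 - c / 2) * t⁻¹ - √a) * w t + 1 / 2 * v t) atTop
        (𝓝 (-√a)) := by
      have hv0 : Tendsto v atTop (𝓝 0) := by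
        have h := (amplitude_expansion ha hw hv h1 hvb 1).2
        simp only [partialSumDeriv, Finset.sum_range_one, Nat.cast_zero, neg_zero, zero_mul,
          mul_zero, sub_zero] at h
        exact h.trans_tendsto (tendsto_inv_pow_zero one_ne_zero)
      have h := (((tendsto_inv_atTop_zero.const_mul (1 / 4 - c / 2)).sub_const √a).mul h1).add
        (hv0.const_mul (1 / 2))
      simpa using h
    filter_upwards [(hlim.comp hsqrt).eventually (Iio_mem_nhds (neg_lt_zero.2 hs)),
      eventually_gt_atTop 0] with x hx hx0
    rw [(hasDerivAt_lift ha c hw hx0).deriv]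
    have ht : 0 < (√x)⁻¹ := inv_pos.2 (Real.sqrt_pos.2 hx0)
    have hx : ((1 / 4 - c / 2) * (√x)⁻¹ - √a) * w √x + 1 / 2 * v √x < 0 := hx
    have e : ampDeriv a c w v √x =
        (√x)⁻¹ * (((1 / 4 - c / 2) * (√x)⁻¹ - √a) * w √x + 1 / 2 * v √x) := by
      rw [ampDeriv]
      ring
    rw [lift, e]
    exact mul_neg_of_pos_of_neg (scale_pos a c 0 hx0) (mul_neg_of_pos_of_neg ht hx)
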